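/- Let $f:[0,\infty)\to[0,\infty)$ be monotonically increasing (not necessarily strictly, and not necessarily continuous). Let $\{Y_t\}_{t\ge 0}$, defined on a probability space $(\Omega,\mathcal F,\mathbf P)$, be the continuous-time inhomogeneous birth–death process on $\mathbb N=\{0,1,2,\dots\}$ with $Y_0=1$, whose birth rate at time $t$ is $f(t)$ (in every state, including $0$) and whose death rate at time $t$ is $Y_t$. That is, the paths $t\mapsto Y_t(\omega)$ are right-continuous step functions with finitely many jumps in bounded time, all jumps being $\pm1$, and the law of $Y$ is that of the process with the time-dependent generator $$(L_t\varphi)(n)=f(t)\,\bigl(\varphi(n+1)-\varphi(n)\bigr)+n\,\bigl(\varphi(n-1)-\varphi(n)\bigr),$$ meaning that $\varphi(Y_t)-\int_0^t (L_s\varphi)(Y_s)\,ds$ is a martingale in the natural filtration of $Y$ for every finitely supported $\varphi:\mathbb N\to\mathbb R$ (the term with $\varphi(n-1)$ is absent for $n=0$). Let $V(\omega)\in\{0,1,2,\dots\}\cup\{\infty\}$ be the number of times $t>0$ at which the path $t\mapsto Y_t(\omega)$ jumps from $0$ to $1$. Then $$\mathbf P(V=\infty)=1\quad\text{if and only if}\quad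 \int_0^\infty e^{-f(t)}f(t)\,dt=\infty ,$$ and if $\int_0^\infty e^{-f(t)}f(t)\,dt<\infty$, then $\mathbf P(V=\infty)=0$. -/

import Mathlib

open MeasureTheory ProbabilityTheory Filter Topology
open scoped NNReal ENNReal

noncomputable section

/-- Trajectories of a birth–death process: `ℕ`-valued step functions on `[0, ∞)` that are
right-continuous, have left limits (so that only finitely many jumps occur in bounded time), and
all of whose jumps are equal to `+1` or `-1`. -/
structure IsBirthDeathPath (w : ℝ≥0 → ℕ) : Prop where
  right_cont : ∀ t : ℝ≥0, ∀ᶠ s in 𝓝[>] t, w s = w t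
  left_lim : ∀ t : ℝ≥0, 0 < t →
    ∃ n : ℕ, (∀ᶠ s in 𝓝[<] t, w s = n) ∧ (w t = n ∨ w t = n + 1 ∨ w t + 1 = n)

/-- The generator at time `t` of the birth–death process with birth rate `birth t n` and death
rate `death t n` in state `n` at time `t`. There is no death in state `0`: for `n = 0` the
truncated difference `n - 1` is `0` and the last term vanishes. -/
def birthDeathGenerator (birth death : ℝ≥0 → ℕ → ℝ) (t : ℝ≥0) (φ : ℕ → ℝ) (n : ℕ) : ℝ :=
  birth t n * (φ (n + 1) - φ n) + death t n * (φ (n - 1) - φ n)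

/-- `Y` is a (time-inhomogeneous) birth–death process on the probability space `(Ω, P)` with birth
rate `birth t n` and death rate `death t n` in state `n` at time `t`: its trajectories are
birth–death paths and its law solves the martingale problem of the generator, that is,
`φ (Y t) - ∫ s in [0, t], (L_s φ) (Y s) ds` is a martingale with respect to the natural filtration
of `Y`, for all finitely supported `φ : ℕ → ℝ`. -/
structure IsBirthDeathProcess {Ω : Type*} [MeasurableSpace Ω] (P : Measure Ω)
    (birth death : ℝ≥0 → ℕ → ℝ) (Y : ℝ≥0 → Ω → ℕ) : Prop where
  measurable : ∀ t : ℝ≥0, Measurable (Y t)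
  paths : ∀ ω : Ω, IsBirthDeathPath (fun t => Y t ω)
  martingale : ∀ φ : ℕ → ℝ, φ.support.Finite →
    Martingale
      (fun (t : ℝ≥0) (ω : Ω) =>
        φ (Y t ω) - ∫ s in (0 : ℝ)..(t : ℝ),
          birthDeathGenerator birth death s.toNNReal φ (Y s.toNNReal ω))
      (Filtration.natural Y fun t => (measurable t).stronglyMeasurable) P

/-- The number, possibly infinite, of times at which the path `w` jumps from `0` to `1`. -/
def jumpsZeroOne (w : ℝ≥0 → ℕ) : ℕ∞ :=
  Set.encard {t : ℝ≥0 | 0 < t ∧ (∀ᶠ s in 𝓝[<] t, w s = 0) ∧ w t = 1}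

end

/-!
The proof rests on one explicit formula. Write `load s t = ∫ v in s..t, e ^ (-(t - v)) * f v`. Given
the past up to time `s`, the process is empty at time `t` with probability
`(1 - e ^ (-(t - s))) ^ Y s * e ^ (-load s t)`
(`IsImmigrationDeathProcess.measureReal_inter_eq_zero`): the individuals alive at time `s` die
independently, and those born later and still alive at time `t` form a Poisson variable. It is
derived from the martingale problem by following `r ↦ E[1_B z(r) ^ Y r]` along the characteristic
`z(r) = 1 - e ^ (-(t - r))`, where deaths and the motion of `z` cancel; multiplied by
`e ^ (-load r t)` this function has right derivative zero. In particular `Y` is empty at time `t`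
with probability `(1 - e ^ (-t)) * e ^ (-load 0 t)`, and returns from `0` at time `s` to `0` at
time `t` with probability `e ^ (-load s t)`.

Suppose that the integral converges. Counting the cells `[k δ, (k + 1) δ]` with `Y = 0` at the left
end and `Y ≠ 0` at the right end, Fatou's lemma bounds the expected number of jumps from `0` to `1`
by the lower limit, as `δ → 0`, of `∑ e ^ (-load 0 (k δ)) * (1 - e ^ (-load (k δ) ((k + 1) δ)))`.
Since `load 0` has derivative `f - load 0`, it is either within `1` of `f`, or it grows at rate at
least `1`; the first case contributes a Riemann sum of `f * e ^ (-f)`, the second one a telescoping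
sum (`exp_neg_load_mul_le`). So the expected number of jumps is finite.

Suppose that the integral diverges. Along a mesh with steps `t (k + 1) - t k = 1 / f (t k)` the sum
of `e ^ (-f (t k))` diverges, hence so does the expected number of `k` with `Y (t k) = 0`, because
`load 0 ≤ f`. Starting from `0` at time `t j`, the expected number of later visits to `0` exceeds
the unconditional one at most by an additive constant and a factor close to `1`
(`IsRateMesh.exists_sum_exp_neg_load_le`). Decomposing according to the first visit, the mesh is
visited at `0` with probability at least `1 - e ^ (-t 0)`
(`IsImmigrationDeathProcess.le_measureReal_iUnion_eq_zero`); applied to the tails of the mesh, this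
gives infinitely many visits almost surely. Each step of the mesh leaves `0` with probability
bounded below, so the process does not stay at `0`, and it jumps from `0` to `1` infinitely often.
-/

/-! ### The load of the process -/

/-- Mean number of the individuals born during `(s, t]` and still alive at time `t`, when births
occur at rate `F v` at time `v` and every individual dies at rate `1`. -/
noncomputable def load (F : ℝ → ℝ) (s t : ℝ) : ℝ := ∫ v in s..t, Real.exp (-(t - v)) * F v

section Load

variable {F : ℝ → ℝ}

lemma intervalIntegrable_load (hF : Monotone F) (t a b : ℝ) :
    IntervalIntegrable (fun v => Real.exp (-(t - v)) * F v) volume a b :=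
  (hF.intervalIntegrable (μ := volume)).continuousOn_mul (by fun_prop)

lemma integral_exp_sub (s t : ℝ) :
    ∫ v in s..t, Real.exp (-(t - v)) = 1 - Real.exp (-(t - s)) := by
  have h : ∀ v ∈ Set.uIcc s t,
      HasDerivAt (fun v => Real.exp (-(t - v))) (Real.exp (-(t - v))) v := by
    intro v _
    have := (((hasDerivAt_id v).const_sub t).neg).exp
    simpa using this
  rw [intervalIntegral.integral_eq_sub_of_hasDerivAt h
    (Continuous.intervalIntegrable (by fun_prop) _ _)]
  simp

lemma le_load (hF : Monotone F) {s t : ℝ} (hst : s ≤ t) :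
    F s * (1 - Real.exp (-(t - s))) ≤ load F s t := by
  rw [← integral_exp_sub, mul_comm, ← intervalIntegral.integral_mul_const, load]
  refine intervalIntegral.integral_mono_on hst (Continuous.intervalIntegrable (by fun_prop) _ _)
    (intervalIntegrable_load hF _ _ _) fun v hv => ?_
  exact mul_le_mul_of_nonneg_left (hF hv.1) (Real.exp_nonneg _)

lemma load_le (hF : Monotone F) {s t : ℝ} (hst : s ≤ t) :
    load F s t ≤ F t * (1 - Real.exp (-(t - s))) := by
  rw [← integral_exp_sub, mul_comm, ← intervalIntegral.integral_mul_const, load]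
  refine intervalIntegral.integral_mono_on hst (intervalIntegrable_load hF _ _ _)
    (Continuous.intervalIntegrable (by fun_prop) _ _) fun v hv => ?_
  exact mul_le_mul_of_nonneg_left (hF hv.2) (Real.exp_nonneg _)

lemma load_nonneg (hF : Monotone F) (hF0 : ∀ v, 0 ≤ F v) {s t : ℝ} (hst : s ≤ t) :
    0 ≤ load F s t :=
  (mul_nonneg (hF0 s) (by simpa using hst)).trans (le_load hF hst)

lemma load_le_rate (hF : Monotone F) (hF0 : ∀ v, 0 ≤ F v) {s t : ℝ} (hst : s ≤ t) :
    load F s t ≤ F t :=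
  (load_le hF hst).trans
    (mul_le_of_le_one_right (hF0 t) (by linarith [Real.exp_pos (-(t - s))]))

lemma load_split (hF : Monotone F) (s r t : ℝ) :
    load F s t = Real.exp (-(t - r)) * load F s r + load F r t := by
  unfold load
  rw [← intervalIntegral.integral_add_adjacent_intervals (intervalIntegrable_load hF t s r)
    (intervalIntegrable_load hF t r t), ← intervalIntegral.integral_const_mul]
  congr 2
  funext v
  rw [← mul_assoc, ← Real.exp_add]
  ring_nf

lemma load_mono_right (hF : Monotone F) (hF0 : ∀ v, 0 ≤ F v) {s r t : ℝ} (hsr : s ≤ r)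
    (hrt : r ≤ t) : load F s r ≤ load F s t := by
  rw [load_split hF s r t]
  have h1 := le_load hF hrt
  have h2 : load F s r * (1 - Real.exp (-(t - r))) ≤ F r * (1 - Real.exp (-(t - r))) :=
    mul_le_mul_of_nonneg_right (load_le_rate hF hF0 hsr) (by simpa using hrt)
  linarith

/-- Only a right derivative exists in general, and it involves the right limit `c` of `F`, since a
monotone rate may jump. -/
lemma hasDerivWithinAt_load_left (hF : Monotone F) (r t : ℝ) {c : ℝ}
    (hc : Tendsto F (𝓝[>] r) (𝓝 c)) :
    HasDerivWithinAt (fun s => load F s t) (-(Real.exp (-(t - r)) * c)) (Set.Ici r) r := by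
  have hlim : Tendsto (fun v => Real.exp (-(t - v)) * F v) (𝓝[>] r)
      (𝓝 (Real.exp (-(t - r)) * c)) :=
    Tendsto.mul (((by fun_prop : Continuous fun v => Real.exp (-(t - v))).tendsto r).mono_left
      nhdsWithin_le_nhds) hc
  refine intervalIntegral.integral_hasDerivWithinAt_of_tendsto_ae_left
    (t := Set.Ioi r) (intervalIntegrable_load hF t r t) ?_ (hlim.mono_left inf_le_left)
  refine ⟨Set.univ, univ_mem, ?_⟩
  exact ((by fun_prop : Continuous fun v => Real.exp (-(t - v))).measurable.mul
    hF.measurable).aestronglyMeasurable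

lemma continuous_load_left (hF : Monotone F) (t : ℝ) : Continuous fun s => load F s t := by
  have : (fun s => load F s t) = fun s => -∫ v in t..s, Real.exp (-(t - v)) * F v := by
    funext s; rw [load, intervalIntegral.integral_symm]
  rw [this]
  exact (intervalIntegral.continuous_primitive
    (fun a b => intervalIntegrable_load hF t a b) t).neg

end Load

/-! ### Generator, measurability and the martingale property -/

section PowerBounds

/-- The rate of change of `z ^ n` due to deaths is bounded uniformly in `n`. -/
lemma natCast_mul_pow_sub_one_mul_le_one {z : ℝ} (h0 : 0 ≤ z) (h1 : z ≤ 1) (n : ℕ) :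
    n * z ^ (n - 1) * (1 - z) ≤ 1 := by
  have h2 : (n : ℝ) * z ^ (n - 1) ≤ ∑ i ∈ Finset.range n, z ^ i := by
    have : ∀ i ∈ Finset.range n, z ^ (n - 1) ≤ z ^ i := fun i hi =>
      pow_le_pow_of_le_one h0 h1 (by have := Finset.mem_range.1 hi; omega)
    simpa using Finset.sum_le_sum this
  calc n * z ^ (n - 1) * (1 - z) ≤ (∑ i ∈ Finset.range n, z ^ i) * (1 - z) :=
        mul_le_mul_of_nonneg_right h2 (by linarith)
    _ = 1 - z ^ n := by rw [mul_comm, mul_neg_geom_sum]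
    _ ≤ 1 := by linarith [pow_nonneg h0 n]

lemma natCast_mul_pow_sub_pow {z : ℝ} (n : ℕ) :
    (n : ℝ) * (z ^ (n - 1) - z ^ n) = n * z ^ (n - 1) * (1 - z) := by
  cases n with
  | zero => simp
  | succ m => simp only [Nat.add_sub_cancel]; ring

lemma abs_one_sub_exp_pow_sub_le {t r r' : ℝ} (hr : r ≤ t) (hr' : r' ≤ t) (n : ℕ) :
    |(1 - Real.exp (-(t - r'))) ^ n - (1 - Real.exp (-(t - r))) ^ n| ≤ |r' - r| := by
  have hd : ∀ x ∈ Set.Iic t, HasDerivWithinAt (fun x => (1 - Real.exp (-(t - x))) ^ n)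
      (n * (1 - Real.exp (-(t - x))) ^ (n - 1) * (-Real.exp (-(t - x)))) (Set.Iic t) x := by
    intro x _
    have h1 := ((((hasDerivAt_id x).const_sub t).neg).exp.const_sub 1).fun_pow n
    simpa using h1.hasDerivWithinAt
  have hb : ∀ x ∈ Set.Iic t,
      ‖n * (1 - Real.exp (-(t - x))) ^ (n - 1) * (-Real.exp (-(t - x)))‖ ≤ 1 := by
    intro x hx
    have h0 : 0 ≤ 1 - Real.exp (-(t - x)) := by
      have : -(t - x) ≤ 0 := by have : x ≤ t := hx; linarith
      linarith [Real.exp_le_one_iff.2 this]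
    have h1 := natCast_mul_pow_sub_one_mul_le_one h0 (by linarith [Real.exp_pos (-(t - x))]) n
    rw [mul_neg, norm_neg, Real.norm_of_nonneg (by positivity)]
    simpa using h1
  simpa using Convex.norm_image_sub_le_of_norm_hasDerivWithin_le hd hb (convex_Iic t) hr hr'

end PowerBounds

section Generator

/-- The generator with birth rate `f t` in every state and death rate `1` per individual. -/
noncomputable abbrev immigrationDeathGenerator (f : ℝ≥0 → ℝ≥0) :
    ℝ≥0 → (ℕ → ℝ) → ℕ → ℝ :=
  birthDeathGenerator (fun t _ => (f t : ℝ)) (fun _ n => (n : ℝ))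

variable {f : ℝ≥0 → ℝ≥0}

lemma abs_generator_le {φ : ℕ → ℝ} {K : ℝ} (h0 : ∀ n, 0 ≤ φ n) (h1 : ∀ n, φ n ≤ 1)
    (hK : ∀ n : ℕ, |n * (φ (n - 1) - φ n)| ≤ K) (t : ℝ≥0) (n : ℕ) :
    |immigrationDeathGenerator f t φ n| ≤ f t + K := by
  have hb : |(f t : ℝ) * (φ (n + 1) - φ n)| ≤ f t := by
    rw [abs_mul, abs_of_nonneg (f t).coe_nonneg]
    refine mul_le_of_le_one_right (f t).coe_nonneg (abs_le.2 ⟨?_, ?_⟩)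
    · linarith [h0 (n + 1), h1 n]
    · linarith [h1 (n + 1), h0 n]
  exact (abs_add_le _ _).trans (add_le_add hb (hK n))

lemma generator_pow (z : ℝ) (t : ℝ≥0) (n : ℕ) :
    immigrationDeathGenerator f t (fun n => z ^ n) n =
      f t * ((z - 1) * z ^ n) + n * z ^ (n - 1) * (1 - z) := by
  simp only [birthDeathGenerator]
  rw [natCast_mul_pow_sub_pow]
  ring

lemma abs_death_pow_le {z : ℝ} (h0 : 0 ≤ z) (h1 : z ≤ 1) (n : ℕ) :
    |(n : ℝ) * (z ^ (n - 1) - z ^ n)| ≤ 1 := by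
  rw [natCast_mul_pow_sub_pow, abs_of_nonneg]
  · exact natCast_mul_pow_sub_one_mul_le_one h0 h1 n
  · have := sub_nonneg.2 h1
    positivity

end Generator

section ImmigrationDeath

variable {Ω : Type*} [MeasurableSpace Ω] {P : Measure Ω} {f : ℝ≥0 → ℝ≥0} {Y : ℝ≥0 → Ω → ℕ}

/-- A right-continuous process is the limit of its values at the grid points that follow a given
time. -/
lemma measurable_uncurry_of_rightContinuous (hm : ∀ t, Measurable (Y t))
    (hr : ∀ ω t, ∀ᶠ s in 𝓝[>] t, Y s ω = Y t ω) :
    Measurable fun p : ℝ≥0 × Ω => Y p.1 p.2 := by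
  let g : ℕ → ℝ≥0 → ℝ≥0 := fun n t => ((⌊t * (n + 1)⌋₊ : ℝ≥0) + 1) / (n + 1)
  have hg : ∀ t, Tendsto (fun n => g n t) atTop (𝓝[>] t) := by
    intro t
    refine tendsto_nhdsWithin_iff.2 ⟨?_, Eventually.of_forall fun n => ?_⟩
    · have h1 : Tendsto (fun n : ℕ => t + 1 / ((n : ℝ≥0) + 1)) atTop (𝓝 t) := by
        simpa using tendsto_const_nhds.add
          (tendsto_one_div_add_atTop_nhds_zero_nat (𝕜 := ℝ≥0))
      refine tendsto_of_tendsto_of_tendsto_of_le_of_le tendsto_const_nhds h1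
        (fun n => ?_) fun n => ?_
      · exact (le_div_iff₀ n.cast_add_one_pos).2 (Nat.lt_floor_add_one _).le
      · have : ((⌊t * (n + 1)⌋₊ : ℝ≥0)) ≤ t * (n + 1) := Nat.floor_le zero_le
        refine (div_le_iff₀ n.cast_add_one_pos).2 ?_
        rw [add_mul, one_div, inv_mul_cancel₀ (by positivity : (n : ℝ≥0) + 1 ≠ 0)]
        gcongr
    · change t < ((⌊t * (n + 1)⌋₊ : ℝ≥0) + 1) / (n + 1)
      exact (lt_div_iff₀ n.cast_add_one_pos).2 (Nat.lt_floor_add_one _)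
  refine measurable_of_tendsto_metrizable (f := fun n (p : ℝ≥0 × Ω) => Y (g n p.1) p.2)
    (fun n => ?_) (tendsto_pi_nhds.2 fun p => ?_)
  · have h1 : Measurable fun q : ℕ × Ω => Y (((q.1 : ℝ≥0) + 1) / ((n : ℝ≥0) + 1)) q.2 :=
      measurable_from_prod_countable_right fun k => hm ((k + 1) / (n + 1))
    have h2 : Measurable fun p : ℝ≥0 × Ω => (⌊p.1 * ((n : ℝ≥0) + 1)⌋₊, p.2) :=
      (Nat.measurable_floor.comp (measurable_fst.mul_const _)).prodMk measurable_snd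
    simpa only [g, Function.comp_def] using h1.comp h2
  · exact tendsto_const_nhds.congr' (((hg p.1).eventually (hr p.2 p.1)).mono fun n hn => hn.symm)

/-- The natural filtration of a process. -/
abbrev pastFiltration (hm : ∀ t, Measurable (Y t)) : Filtration ℝ≥0 ‹MeasurableSpace Ω› :=
  Filtration.natural Y fun t => (hm t).stronglyMeasurable

lemma measurable_uncurry_generator (hf : Monotone f) (hm : ∀ t, Measurable (Y t))
    (hr : ∀ ω t, ∀ᶠ s in 𝓝[>] t, Y s ω = Y t ω) (φ : ℕ → ℝ) :
    Measurable fun p : Ω × ℝ => immigrationDeathGenerator f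
      p.2.toNNReal φ (Y p.2.toNNReal p.1) := by
  have hY : Measurable fun p : Ω × ℝ => Y p.2.toNNReal p.1 :=
    (measurable_uncurry_of_rightContinuous hm hr).comp
      ((measurable_real_toNNReal.comp measurable_snd).prodMk measurable_fst)
  have hfm : Measurable fun p : Ω × ℝ => (f p.2.toNNReal : ℝ) :=
    measurable_coe_nnreal_real.comp
      (hf.measurable.comp (measurable_real_toNNReal.comp measurable_snd))
  have hc : ∀ g : ℕ → ℝ, Measurable fun p : Ω × ℝ => g (Y p.2.toNNReal p.1) := fun g =>
    (measurable_from_nat (f := g)).comp hY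
  exact (hfm.mul ((hc fun n => φ (n + 1)).sub (hc φ))).add
    ((hc fun n => (n : ℝ)).mul ((hc fun n => φ (n - 1)).sub (hc φ)))

lemma monotone_rate (hf : Monotone f) : Monotone fun v : ℝ => (f v.toNNReal : ℝ) :=
  fun _ _ h => NNReal.coe_le_coe.2 (hf (Real.toNNReal_le_toNNReal h))

lemma abs_generator_le_of_le (hf : Monotone f) {φ : ℕ → ℝ} {K : ℝ} (h0 : ∀ n, 0 ≤ φ n)
    (h1 : ∀ n, φ n ≤ 1) (hK : ∀ n : ℕ, |n * (φ (n - 1) - φ n)| ≤ K) {t : ℝ≥0} {u : ℝ}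
    (hu : u ≤ t) (n : ℕ) :
    |immigrationDeathGenerator f u.toNNReal φ n| ≤
      f t + K :=
  (abs_generator_le h0 h1 hK _ _).trans
    (add_le_add_left (NNReal.coe_le_coe.2 (hf (Real.toNNReal_le_iff_le_coe.2 hu))) K)

/-- The birth–death process with birth rate `f t` in every state and death rate `1` per
individual. -/
abbrev IsImmigrationDeathProcess (P : Measure Ω) (f : ℝ≥0 → ℝ≥0) (Y : ℝ≥0 → Ω → ℕ) : Prop :=
  IsBirthDeathProcess P (fun t _ => (f t : ℝ)) (fun _ n => (n : ℝ)) Y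

variable [IsProbabilityMeasure P]

lemma intervalIntegrable_generator (hf : Monotone f) (hm : ∀ t, Measurable (Y t))
    (hr : ∀ ω t, ∀ᶠ s in 𝓝[>] t, Y s ω = Y t ω) {φ : ℕ → ℝ} {K : ℝ} (h0 : ∀ n, 0 ≤ φ n)
    (h1 : ∀ n, φ n ≤ 1) (hK : ∀ n : ℕ, |n * (φ (n - 1) - φ n)| ≤ K) (r r' : ℝ≥0) (ω : Ω) :
    IntervalIntegrable (fun u : ℝ => immigrationDeathGenerator f u.toNNReal φ (Y u.toNNReal ω))
        volume r r' := by
  refine (intervalIntegrable_const (c := (f (max r r') : ℝ) + K)).mono_fun ?_ ?_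
  · exact ((measurable_uncurry_generator hf hm hr φ).comp
      measurable_prodMk_left).aestronglyMeasurable
  · refine (ae_restrict_iff' measurableSet_uIoc).2 (Eventually.of_forall fun u hu => ?_)
    have hu' : u ≤ ((max r r' : ℝ≥0) : ℝ) := by
      have := hu.2
      simpa using this
    have h := abs_generator_le_of_le hf h0 h1 hK hu' (Y u.toNNReal ω)
    exact h.trans (le_abs_self _)

lemma measurable_integral_generator (hf : Monotone f) (hm : ∀ t, Measurable (Y t))
    (hr : ∀ ω t, ∀ᶠ s in 𝓝[>] t, Y s ω = Y t ω) (φ : ℕ → ℝ) (r r' : ℝ) :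
    Measurable fun ω => ∫ u in r..r', immigrationDeathGenerator f u.toNNReal φ (Y u.toNNReal ω) :=
        by
  have h := (measurable_uncurry_generator hf hm hr φ).stronglyMeasurable
  simp only [intervalIntegral]
  exact ((h.integral_prod_right (f := fun ω (u : ℝ) => immigrationDeathGenerator f u.toNNReal φ (Y
      u.toNNReal ω))).sub
    (h.integral_prod_right (f := fun ω (u : ℝ) => immigrationDeathGenerator f u.toNNReal φ (Y
        u.toNNReal ω)))).measurable

lemma abs_integral_generator_le (hf : Monotone f) {φ : ℕ → ℝ} {K : ℝ} (h0 : ∀ n, 0 ≤ φ n)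
    (h1 : ∀ n, φ n ≤ 1) (hK : ∀ n : ℕ, |n * (φ (n - 1) - φ n)| ≤ K) {r r' t : ℝ≥0}
    (hrr' : r ≤ r') (ht : r' ≤ t) (w : ℝ≥0 → ℕ) :
    |∫ u in (r : ℝ)..r', immigrationDeathGenerator f
      u.toNNReal φ (w u.toNNReal)| ≤ (f t + K) * (r' - r) := by
  have hrr : (r : ℝ) ≤ r' := hrr'
  have h := intervalIntegral.norm_integral_le_of_norm_le_const (a := (r : ℝ)) (b := r')
    (C := f t + K) (f := fun u => immigrationDeathGenerator f u.toNNReal φ (w u.toNNReal)) fun u hu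
        => ?_
  · rwa [abs_of_nonneg (sub_nonneg.2 hrr)] at h
  · rw [Set.uIoc_of_le hrr] at hu
    exact abs_generator_le_of_le hf h0 h1 hK (hu.2.trans (NNReal.coe_le_coe.2 ht)) _

lemma integrable_comp_of_bounded (hm : ∀ t, Measurable (Y t)) {φ : ℕ → ℝ} (h0 : ∀ n, 0 ≤ φ n)
    (h1 : ∀ n, φ n ≤ 1) (r : ℝ≥0) : Integrable (fun ω => φ (Y r ω)) P :=
  Integrable.of_bound ((measurable_from_nat (f := φ)).comp (hm r)).aestronglyMeasurable 1
    (Eventually.of_forall fun ω => by rw [Real.norm_of_nonneg (h0 _)]; exact h1 _)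

lemma integrable_integral_generator (hf : Monotone f) (hm : ∀ t, Measurable (Y t))
    (hr : ∀ ω t, ∀ᶠ s in 𝓝[>] t, Y s ω = Y t ω) {φ : ℕ → ℝ} {K : ℝ} (h0 : ∀ n, 0 ≤ φ n)
    (h1 : ∀ n, φ n ≤ 1) (hK : ∀ n : ℕ, |n * (φ (n - 1) - φ n)| ≤ K) {r r' : ℝ≥0}
    (hrr' : r ≤ r') :
    Integrable (fun ω => ∫ u in (r : ℝ)..r', immigrationDeathGenerator f u.toNNReal φ (Y u.toNNReal
        ω)) P :=
  Integrable.of_bound (measurable_integral_generator hf hm hr φ _ _).aestronglyMeasurable _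
    (Eventually.of_forall fun ω => abs_integral_generator_le hf h0 h1 hK hrr' le_rfl fun s => Y s ω)

/-- The martingale property of `φ (Y t) - ∫ L φ (Y)`, integrated over an event of the past. -/
lemma IsImmigrationDeathProcess.setIntegral_sub_of_finite (hf : Monotone f)
    (hY : IsImmigrationDeathProcess P f Y) {φ : ℕ → ℝ} {K : ℝ}
    (h0 : ∀ n, 0 ≤ φ n) (h1 : ∀ n, φ n ≤ 1) (hK : ∀ n : ℕ, |n * (φ (n - 1) - φ n)| ≤ K)
    (hφ : φ.support.Finite) {r r' : ℝ≥0} (hrr' : r ≤ r') {B : Set Ω}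
    (hB : MeasurableSet[pastFiltration hY.measurable r] B) :
    ∫ ω in B, (φ (Y r' ω) - φ (Y r ω)) ∂P =
      ∫ ω in B, (∫ u in (r : ℝ)..r', immigrationDeathGenerator f u.toNNReal φ (Y u.toNNReal ω)) ∂P
          := by
  have hrc : ∀ ω t, ∀ᶠ s in 𝓝[>] t, Y s ω = Y t ω := fun ω t => (hY.paths ω).right_cont t
  have hi := fun s => integrable_comp_of_bounded (P := P) hY.measurable h0 h1 s
  have hg := fun s : ℝ≥0 => integrable_integral_generator (P := P) hf hY.measurable hrc h0 h1 hK
    (zero_le (a := s))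
  have h := (hY.martingale φ hφ).setIntegral_eq hrr' hB
  simp only [NNReal.coe_zero] at hg
  rw [integral_sub (hi r).integrableOn (hg r).integrableOn,
    integral_sub (hi r').integrableOn (hg r').integrableOn] at h
  rw [integral_sub (hi r').integrableOn (hi r).integrableOn]
  have h2 : ∀ ω, ∫ u in (r : ℝ)..r', immigrationDeathGenerator f u.toNNReal φ (Y u.toNNReal ω) =
      (∫ u in (0 : ℝ)..r', immigrationDeathGenerator f u.toNNReal φ (Y u.toNNReal ω)) -
      ∫ u in (0 : ℝ)..r, immigrationDeathGenerator f u.toNNReal φ (Y u.toNNReal ω) := fun ω => by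
    have hii := fun s => intervalIntegrable_generator hf hY.measurable hrc h0 h1 hK 0 s ω
    simp only [NNReal.coe_zero] at hii
    rw [intervalIntegral.integral_interval_sub_left (hii r') (hii r)]
  simp_rw [h2]
  rw [integral_sub (hg r').integrableOn (hg r).integrableOn]
  linarith

/-- The martingale property extends from finitely supported functions to `n ↦ z ^ n` with `z < 1`,
because `n * z ^ n` is bounded. -/
lemma IsImmigrationDeathProcess.setIntegral_pow_sub (hf : Monotone f)
    (hY : IsImmigrationDeathProcess P f Y) {z : ℝ}
    (hz0 : 0 ≤ z) (hz1 : z < 1) {r r' : ℝ≥0} (hrr' : r ≤ r') {B : Set Ω}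
    (hB : MeasurableSet[pastFiltration hY.measurable r] B) :
    ∫ ω in B, (z ^ Y r' ω - z ^ Y r ω) ∂P =
      ∫ ω in B, (∫ u in (r : ℝ)..r', immigrationDeathGenerator f u.toNNReal (fun n => z ^ n) (Y
          u.toNNReal ω)) ∂P := by
  have hrc : ∀ ω t, ∀ᶠ s in 𝓝[>] t, Y s ω = Y t ω := fun ω t => (hY.paths ω).right_cont t
  let φ : ℕ → ℕ → ℝ := fun N n => if n ≤ N then z ^ n else 0
  have h0 : ∀ N n, 0 ≤ φ N n := fun N n => by
    simp only [φ]; split_ifs <;> positivity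
  have hle : ∀ N n, φ N n ≤ z ^ n := fun N n => by
    simp only [φ]; split_ifs
    · exact le_rfl
    · positivity
  have h1 : ∀ N n, φ N n ≤ 1 := fun N n => (hle N n).trans (pow_le_one₀ hz0 hz1.le)
  have hz : 0 < 1 - z := by linarith
  have hbd : ∀ n : ℕ, n * z ^ (n - 1) ≤ 1 / (1 - z) := fun n =>
    (le_div_iff₀ hz).2 (natCast_mul_pow_sub_one_mul_le_one hz0 hz1.le n)
  have hK : ∀ N, ∀ n : ℕ, |n * (φ N (n - 1) - φ N n)| ≤ 1 / (1 - z) := by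
    intro N n
    have ha : n * φ N (n - 1) ≤ 1 / (1 - z) :=
      (mul_le_mul_of_nonneg_left (hle N _) n.cast_nonneg).trans (hbd n)
    have hb : n * φ N n ≤ 1 / (1 - z) := by
      refine (mul_le_mul_of_nonneg_left (hle N _) n.cast_nonneg).trans (le_trans ?_ (hbd n))
      exact mul_le_mul_of_nonneg_left (pow_le_pow_of_le_one hz0 hz1.le (Nat.sub_le _ _))
        n.cast_nonneg
    have ha' : 0 ≤ n * φ N (n - 1) := mul_nonneg n.cast_nonneg (h0 _ _)
    have hb' : 0 ≤ n * φ N n := mul_nonneg n.cast_nonneg (h0 _ _)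
    rw [mul_sub, abs_le]
    constructor <;> linarith
  have hφ : ∀ N, (φ N).support.Finite := fun N =>
    (Set.finite_Iic N).subset fun n hn => by
      by_contra hc
      exact hn (if_neg hc)
  have hev : ∀ n, ∀ᶠ N in atTop, φ N n = z ^ n := fun n =>
    (eventually_ge_atTop n).mono fun N hN => if_pos hN
  have hL : Tendsto (fun N => ∫ ω in B, (φ N (Y r' ω) - φ N (Y r ω)) ∂P) atTop
      (𝓝 (∫ ω in B, (z ^ Y r' ω - z ^ Y r ω) ∂P)) := by
    refine tendsto_integral_filter_of_dominated_convergence (fun _ => 1)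
      (Eventually.of_forall fun N => ?_) (Eventually.of_forall fun N => ?_)
      (integrable_const _) (Eventually.of_forall fun ω => ?_)
    · exact (((measurable_from_nat (f := φ N)).comp (hY.measurable r')).sub
        ((measurable_from_nat (f := φ N)).comp (hY.measurable r))).aestronglyMeasurable
    · refine Eventually.of_forall fun ω => ?_
      rw [Real.norm_eq_abs, abs_le]
      constructor <;> linarith [h0 N (Y r' ω), h1 N (Y r' ω), h0 N (Y r ω), h1 N (Y r ω)]
    · refine tendsto_const_nhds.congr' ?_
      filter_upwards [hev (Y r' ω), hev (Y r ω)] with N ha hb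
      rw [ha, hb]
  have hR : Tendsto (fun N => ∫ ω in B, (∫ u in (r : ℝ)..r',
        immigrationDeathGenerator f u.toNNReal (φ N)
          (Y u.toNNReal ω)) ∂P) atTop
      (𝓝 (∫ ω in B, (∫ u in (r : ℝ)..r', immigrationDeathGenerator f u.toNNReal (fun n => z ^ n) (Y
          u.toNNReal ω)) ∂P)) := by
    refine tendsto_integral_filter_of_dominated_convergence
      (fun _ => (f r' + 1 / (1 - z)) * (r' - r))
      (Eventually.of_forall fun N => ?_) (Eventually.of_forall fun N => ?_)
      (integrable_const _) (Eventually.of_forall fun ω => ?_)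
    · exact (measurable_integral_generator hf hY.measurable hrc _ _ _).aestronglyMeasurable
    · exact Eventually.of_forall fun ω =>
        abs_integral_generator_le hf (h0 N) (h1 N) (hK N) hrr' le_rfl fun s => Y s ω
    · refine intervalIntegral.tendsto_integral_filter_of_dominated_convergence
        (fun _ => f r' + 1 / (1 - z)) (Eventually.of_forall fun N => ?_)
        (Eventually.of_forall fun N => ?_) intervalIntegrable_const
        (Eventually.of_forall fun u _ => ?_)
      · exact ((measurable_uncurry_generator hf hY.measurable hrc (φ N)).comp
          measurable_prodMk_left).aestronglyMeasurable
      · refine Eventually.of_forall fun u hu => ?_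
        rw [Set.uIoc_of_le (NNReal.coe_le_coe.2 hrr')] at hu
        exact abs_generator_le_of_le hf (h0 N) (h1 N) (hK N) hu.2 _
      · refine tendsto_const_nhds.congr' ?_
        filter_upwards [hev (Y u.toNNReal ω), hev (Y u.toNNReal ω - 1),
          hev (Y u.toNNReal ω + 1)] with N ha hb hc
        simp only [birthDeathGenerator, ha, hb, hc]
  refine tendsto_nhds_unique hL (hR.congr fun N => ?_)
  exact (hY.setIntegral_sub_of_finite hf (h0 N) (h1 N) (hK N) (hφ N) hrr' hB).symm

end ImmigrationDeath

/-! ### The generating function along characteristics -/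

section GeneratingFunction

variable {Ω : Type*} [MeasurableSpace Ω] {P : Measure Ω} [IsProbabilityMeasure P]
  {f : ℝ≥0 → ℝ≥0} {Y : ℝ≥0 → Ω → ℕ}

lemma one_sub_exp_neg_nonneg {r t : ℝ} (h : r ≤ t) : 0 ≤ 1 - Real.exp (-(t - r)) := by
  simpa using h

lemma one_sub_exp_lt_one (x : ℝ) : 1 - Real.exp x < 1 := by linarith [Real.exp_pos x]

/-- Increment of the generating function when time and the argument move together. -/
lemma IsImmigrationDeathProcess.setIntegral_pow_increment (hf : Monotone f)
    (hY : IsImmigrationDeathProcess P f Y) {z z' : ℝ} (hz0 : 0 ≤ z) (hz1 : z < 1) (hz0' : 0 ≤ z')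
    (hz1' : z' < 1) {r r' : ℝ≥0} (hrr' : r ≤ r') {B : Set Ω}
    (hB : MeasurableSet[pastFiltration hY.measurable r] B) :
    ∫ ω in B, z' ^ Y r' ω ∂P - ∫ ω in B, z ^ Y r ω ∂P =
      ∫ ω in B, ((∫ u in (r : ℝ)..r', immigrationDeathGenerator f u.toNNReal (fun n => z' ^ n)
        (Y u.toNNReal ω)) + (z' ^ Y r ω - z ^ Y r ω)) ∂P := by
  have hi : ∀ {x : ℝ}, 0 ≤ x → x < 1 → ∀ s, IntegrableOn (fun ω => x ^ Y s ω) B P :=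
    fun {x} h0 h1 s => (integrable_comp_of_bounded hY.measurable (φ := fun n => x ^ n)
      (fun n => pow_nonneg h0 n) (fun n => pow_le_one₀ h0 h1.le) s).integrableOn
  rw [integral_add, ← hY.setIntegral_pow_sub hf hz0' hz1' hrr' hB,
    integral_sub (hi hz0' hz1' _) (hi hz0' hz1' _), integral_sub (hi hz0' hz1' _) (hi hz0 hz1 _)]
  · ring
  · exact (integrable_integral_generator hf hY.measurable (fun ω t => (hY.paths ω).right_cont t)
      (fun n => pow_nonneg hz0' n) (fun n => pow_le_one₀ hz0' hz1'.le)
      (abs_death_pow_le hz0' hz1'.le) hrr').integrableOn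
  · exact (hi hz0' hz1' _).sub (hi hz0 hz1 _)

lemma abs_increment_integrand_le (hf : Monotone f) {r r' t : ℝ≥0} (hrr' : r ≤ r') (ht : r' ≤ t)
    (w : ℝ≥0 → ℕ) :
    |(∫ u in (r : ℝ)..r', immigrationDeathGenerator f u.toNNReal
        (fun n => (1 - Real.exp (-((t : ℝ) - r'))) ^ n) (w u.toNNReal)) +
      ((1 - Real.exp (-((t : ℝ) - r'))) ^ w r - (1 - Real.exp (-((t : ℝ) - r))) ^ w r)| ≤
      (f t + 2) * (r' - r) := by
  have ht' : (r' : ℝ) ≤ t := ht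
  have hr' : (r : ℝ) ≤ r' := hrr'
  have h0 := one_sub_exp_neg_nonneg ht'
  have h1 := (one_sub_exp_lt_one (-((t : ℝ) - r'))).le
  have h2 := abs_integral_generator_le hf (fun n => pow_nonneg h0 n) (fun n => pow_le_one₀ h0 h1)
    (abs_death_pow_le h0 h1) hrr' ht w
  have h3 := abs_one_sub_exp_pow_sub_le (hr'.trans ht') ht' (w r)
  rw [abs_of_nonneg (sub_nonneg.2 hr')] at h3
  refine (abs_add_le _ _).trans ((add_le_add h2 h3).trans_eq ?_)
  ring

lemma IsImmigrationDeathProcess.abs_setIntegral_pow_increment_le (hf : Monotone f)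
    (hY : IsImmigrationDeathProcess P f Y) {r r' t : ℝ≥0} (hrr' : r ≤ r') (ht : r' ≤ t) {B : Set Ω}
    (hB : MeasurableSet[pastFiltration hY.measurable r] B) :
    |∫ ω in B, (1 - Real.exp (-((t : ℝ) - r'))) ^ Y r' ω ∂P -
      ∫ ω in B, (1 - Real.exp (-((t : ℝ) - r))) ^ Y r ω ∂P| ≤ (f t + 2) * (r' - r) := by
  have ht' : (r' : ℝ) ≤ t := ht
  have hr' : (r : ℝ) ≤ r' := hrr'
  rw [hY.setIntegral_pow_increment hf (one_sub_exp_neg_nonneg (hr'.trans ht'))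
    (one_sub_exp_lt_one _) (one_sub_exp_neg_nonneg ht') (one_sub_exp_lt_one _) hrr' hB]
  have hb : ∀ ω ∈ B, ‖(∫ u in (r : ℝ)..r', immigrationDeathGenerator f u.toNNReal
        (fun n => (1 - Real.exp (-((t : ℝ) - r'))) ^ n) (Y u.toNNReal ω)) +
      ((1 - Real.exp (-((t : ℝ) - r'))) ^ Y r ω - (1 - Real.exp (-((t : ℝ) - r))) ^ Y r ω)‖ ≤
      (f t + 2) * (r' - r) := fun ω _ => abs_increment_integrand_le hf hrr' ht fun s => Y s ω
  have h := norm_setIntegral_le_of_norm_le_const (μ := P) (measure_lt_top P B) hb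
  refine h.trans (mul_le_of_le_one_right ?_ measureReal_le_one)
  exact mul_nonneg (by positivity) (sub_nonneg.2 hr')

/-- Along a path that is constant just after time `r`, the difference quotient of the generating
function converges: the deaths are compensated by the motion of `r ↦ 1 - e ^ (-(t - r))`. -/
lemma tendsto_increment_integrand (hf : Monotone f) {r t : ℝ≥0} {c : ℝ}
    (hc : Tendsto (fun v : ℝ => (f v.toNNReal : ℝ)) (𝓝[>] (r : ℝ)) (𝓝 c)) {w : ℝ≥0 → ℕ}
    (hw : ∀ᶠ s in 𝓝[>] r, w s = w r) :
    Tendsto (fun r' : ℝ => (r' - r)⁻¹ * ((∫ u in (r : ℝ)..r', immigrationDeathGenerator f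
        u.toNNReal (fun n => (1 - Real.exp (-((t : ℝ) - r'))) ^ n) (w u.toNNReal)) +
      ((1 - Real.exp (-((t : ℝ) - r'))) ^ w r - (1 - Real.exp (-((t : ℝ) - r))) ^ w r)))
      (𝓝[>] (r : ℝ))
      (𝓝 (-(Real.exp (-((t : ℝ) - r)) * c) * (1 - Real.exp (-((t : ℝ) - r))) ^ w r)) := by
  set n := w r with hn
  set z : ℝ → ℝ := fun x => 1 - Real.exp (-((t : ℝ) - x)) with hz
  have hzc : Continuous z := by fun_prop
  have hzd : HasDerivAt (fun x => z x ^ n)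
      (n * z r ^ (n - 1) * (-Real.exp (-((t : ℝ) - r)))) r := by
    have h1 := ((((hasDerivAt_id (r : ℝ)).const_sub (t : ℝ)).neg).exp.const_sub 1).fun_pow n
    simpa [hz] using h1
  have hFd : HasDerivWithinAt (fun x => ∫ v in (r : ℝ)..x, (f v.toNNReal : ℝ)) c
      (Set.Ioi (r : ℝ)) r := by
    refine (intervalIntegral.integral_hasDerivWithinAt_of_tendsto_ae_right
      (s := Set.Ici (r : ℝ)) (t := Set.Ioi (r : ℝ)) ?_ ?_ (hc.mono_left inf_le_left)).mono
      Set.Ioi_subset_Ici_self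
    · simp
    · exact ⟨Set.univ, univ_mem, (monotone_rate hf).measurable.aestronglyMeasurable⟩
  have s1 := (hasDerivWithinAt_iff_tendsto_slope' (by simp)).1 hFd
  have s2 := (hasDerivWithinAt_iff_tendsto_slope' (by simp)).1
    (hzd.hasDerivWithinAt (s := Set.Ioi (r : ℝ)))
  have hzt : Tendsto z (𝓝[>] (r : ℝ)) (𝓝 (z r)) := (hzc.tendsto _).mono_left nhdsWithin_le_nhds
  have lim := ((((hzt.sub_const 1).mul (hzt.pow n)).mul s1).add
    (((hzt.pow (n - 1)).const_mul (n : ℝ)).mul (hzt.const_sub 1))).add s2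
  have e : (z r - 1) * z r ^ n * c + n * z r ^ (n - 1) * (1 - z r) +
      n * z r ^ (n - 1) * (-Real.exp (-((t : ℝ) - r))) =
      -(Real.exp (-((t : ℝ) - r)) * c) * z r ^ n := by
    simp only [hz]; ring
  rw [e] at lim
  refine lim.congr' ?_
  have hT : Tendsto Real.toNNReal (𝓝[>] (r : ℝ)) (𝓝[>] r) := by
    refine tendsto_nhdsWithin_iff.2 ⟨?_, ?_⟩
    · have := (continuous_real_toNNReal.tendsto (r : ℝ)).mono_left
        (nhdsWithin_le_nhds (s := Set.Ioi (r : ℝ)))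
      simpa using this
    · filter_upwards [self_mem_nhdsWithin] with u hu
      exact Real.lt_toNNReal_iff_coe_lt.2 hu
  obtain ⟨b, hb, hsub⟩ := mem_nhdsGT_iff_exists_Ioo_subset.1 (hT.eventually hw)
  filter_upwards [Ioo_mem_nhdsGT hb] with r' hr'
  have hint : ∫ u in (r : ℝ)..r', immigrationDeathGenerator f u.toNNReal (fun n => z r' ^ n)
      (w u.toNNReal) = ((z r' - 1) * z r' ^ n) * (∫ v in (r : ℝ)..r', (f v.toNNReal : ℝ)) +
        (n * z r' ^ (n - 1) * (1 - z r')) * (r' - r) := by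
    have h1 : ∀ u ∈ Set.uIcc (r : ℝ) r', immigrationDeathGenerator f u.toNNReal
        (fun n => z r' ^ n) (w u.toNNReal) = ((z r' - 1) * z r' ^ n) * (f u.toNNReal : ℝ) +
          n * z r' ^ (n - 1) * (1 - z r') := by
      intro u hu
      rw [Set.uIcc_of_le hr'.1.le] at hu
      have hwu : w u.toNNReal = n := by
        rcases hu.1.eq_or_lt with h | h
        · rw [← h, Real.toNNReal_coe]
        · exact hsub ⟨h, hu.2.trans_lt hr'.2⟩
      rw [generator_pow, hwu]
      ring
    rw [intervalIntegral.integral_congr h1, intervalIntegral.integral_add,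
      intervalIntegral.integral_const_mul, intervalIntegral.integral_const, smul_eq_mul]
    · ring
    · exact ((monotone_rate hf).intervalIntegrable (μ := volume)).const_mul _
    · exact intervalIntegrable_const
  have hne : r' - r ≠ 0 := sub_ne_zero.2 hr'.1.ne'
  change _ = (r' - r)⁻¹ * ((∫ u in (r : ℝ)..r', immigrationDeathGenerator f
        u.toNNReal (fun n => z r' ^ n) (w u.toNNReal)) + (z r' ^ n - z r ^ n))
  rw [hint]
  simp only [slope_def_field, intervalIntegral.integral_same, sub_zero]
  field_simp

lemma IsImmigrationDeathProcess.hasDerivWithinAt_setIntegral_pow (hf : Monotone f)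
    (hY : IsImmigrationDeathProcess P f Y) {r t : ℝ≥0} (ht : r < t) {B : Set Ω}
    (hB : MeasurableSet[pastFiltration hY.measurable r] B) {c : ℝ}
    (hc : Tendsto (fun v : ℝ => (f v.toNNReal : ℝ)) (𝓝[>] (r : ℝ)) (𝓝 c)) :
    HasDerivWithinAt (fun x : ℝ => ∫ ω in B, (1 - Real.exp (-((t : ℝ) - x))) ^ Y x.toNNReal ω ∂P)
      (-(Real.exp (-((t : ℝ) - r)) * c) *
        ∫ ω in B, (1 - Real.exp (-((t : ℝ) - r))) ^ Y r ω ∂P) (Set.Ici r) r := by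
  have hrc : ∀ ω t, ∀ᶠ s in 𝓝[>] t, Y s ω = Y t ω := fun ω t => (hY.paths ω).right_cont t
  have ht' : (r : ℝ) < t := ht
  rw [← hasDerivWithinAt_Ioi_iff_Ici, hasDerivWithinAt_iff_tendsto_slope' (by simp),
    ← integral_const_mul]
  have hmem : ∀ᶠ r' in 𝓝[>] (r : ℝ), r' ∈ Set.Ioo (r : ℝ) t := Ioo_mem_nhdsGT ht'
  have key : Tendsto (fun r' : ℝ => ∫ ω in B, (r' - r)⁻¹ * ((∫ u in (r : ℝ)..r',
        immigrationDeathGenerator f u.toNNReal (fun n => (1 - Real.exp (-((t : ℝ) - r'))) ^ n)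
          (Y u.toNNReal ω)) +
      ((1 - Real.exp (-((t : ℝ) - r'))) ^ Y r ω - (1 - Real.exp (-((t : ℝ) - r))) ^ Y r ω)) ∂P)
      (𝓝[>] (r : ℝ)) (𝓝 (∫ ω in B, -(Real.exp (-((t : ℝ) - r)) * c) *
        (1 - Real.exp (-((t : ℝ) - r))) ^ Y r ω ∂P)) := by
    refine tendsto_integral_filter_of_dominated_convergence (fun _ => (f t : ℝ) + 2)
      (Eventually.of_forall fun r' => ?_) ?_ (integrable_const _)
      (Eventually.of_forall fun ω =>
        tendsto_increment_integrand (t := t) (w := fun s => Y s ω) hf hc (hrc ω r))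
    · have hp : ∀ x : ℝ, Measurable fun ω => x ^ Y r ω := fun x =>
        (measurable_from_nat (f := fun n => x ^ n)).comp (hY.measurable r)
      exact (((measurable_integral_generator hf hY.measurable hrc _ _ _).add
        ((hp _).sub (hp _))).const_mul _).aestronglyMeasurable
    · filter_upwards [hmem] with r' hr'
      refine Eventually.of_forall fun ω => ?_
      lift r' to ℝ≥0 using r.coe_nonneg.trans hr'.1.le
      have hpos : (0 : ℝ) < r' - r := sub_pos.2 hr'.1
      have h := abs_increment_integrand_le hf (NNReal.coe_le_coe.1 hr'.1.le)
        (NNReal.coe_le_coe.1 hr'.2.le) (fun s => Y s ω) (t := t)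
      rw [norm_mul, norm_inv, Real.norm_of_nonneg hpos.le, inv_mul_le_iff₀ hpos, mul_comm]
      exact h
  refine key.congr' ?_
  filter_upwards [hmem] with r' hr'
  lift r' to ℝ≥0 using r.coe_nonneg.trans hr'.1.le
  rw [integral_const_mul, slope_def_field, Real.toNNReal_coe, Real.toNNReal_coe,
    hY.setIntegral_pow_increment hf (one_sub_exp_neg_nonneg ht'.le) (one_sub_exp_lt_one _)
      (one_sub_exp_neg_nonneg hr'.2.le) (one_sub_exp_lt_one _) (NNReal.coe_le_coe.1 hr'.1.le) hB]
  rw [div_eq_inv_mul]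

/-- Emptiness at time `t`, given the past up to time `s`: each of the `Y s` individuals present
has died with probability `1 - e ^ (-(t - s))`, and the survivors among those born in between form
a Poisson variable of mean `load s t`. -/
theorem IsImmigrationDeathProcess.measureReal_inter_eq_zero (hf : Monotone f)
    (hY : IsImmigrationDeathProcess P f Y) {s t : ℝ≥0} (hst : s ≤ t) {B : Set Ω}
    (hB : MeasurableSet[pastFiltration hY.measurable s] B) :
    P.real (B ∩ {ω | Y t ω = 0}) =
      Real.exp (-load (fun v => (f v.toNNReal : ℝ)) s t) *
        ∫ ω in B, (1 - Real.exp (-((t : ℝ) - s))) ^ Y s ω ∂P := by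
  -- The function `x ↦ e ^ (-load x t) * g x` is constant on `[s, t]`; at `t` the base of the
  -- power in `g` is `0`, and `0 ^ Y t` is the indicator of emptiness.
  set F : ℝ → ℝ := fun v => (f v.toNNReal : ℝ) with hF
  have hFm : Monotone F := monotone_rate hf
  set g : ℝ → ℝ := fun x => ∫ ω in B, (1 - Real.exp (-((t : ℝ) - x))) ^ Y x.toNNReal ω ∂P with hg
  have hBr : ∀ {r : ℝ≥0}, s ≤ r → MeasurableSet[pastFiltration hY.measurable r] B := fun h =>
    (pastFiltration hY.measurable).mono h _ hB
  have hlip : ∀ x ∈ Set.Icc (s : ℝ) t, ∀ y ∈ Set.Icc (s : ℝ) t, x ≤ y →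
      |g y - g x| ≤ (f t + 2) * (y - x) := by
    intro x hx y hy hxy
    lift x to ℝ≥0 using s.coe_nonneg.trans hx.1
    lift y to ℝ≥0 using s.coe_nonneg.trans hy.1
    simp only [hg, Real.toNNReal_coe]
    exact hY.abs_setIntegral_pow_increment_le hf (NNReal.coe_le_coe.1 hxy)
      (NNReal.coe_le_coe.1 hy.2) (hBr (NNReal.coe_le_coe.1 hx.1))
  have hgc : ContinuousOn g (Set.Icc (s : ℝ) t) := by
    refine LipschitzOnWith.continuousOn (K := f t + 2)
      (LipschitzOnWith.of_dist_le_mul fun x hx y hy => ?_)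
    rw [Real.dist_eq, Real.dist_eq]
    push_cast
    rcases le_total x y with h | h
    · rw [abs_sub_comm, abs_sub_comm x, abs_of_nonneg (sub_nonneg.2 h)]
      exact hlip x hx y hy h
    · rw [abs_of_nonneg (sub_nonneg.2 h)]
      exact hlip y hy x hx h
  have hconst := constant_of_has_deriv_right_zero (f := fun x => Real.exp (-load F x t) * g x)
    (a := (s : ℝ)) (b := t)
    (((continuous_load_left hFm t).neg.rexp).continuousOn.mul hgc) (fun x hx => by
      lift x to ℝ≥0 using s.coe_nonneg.trans hx.1
      have hc := hFm.tendsto_nhdsGT (x : ℝ)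
      have h1 := (hasDerivWithinAt_load_left hFm x t hc).neg.exp
      have h2 := hY.hasDerivWithinAt_setIntegral_pow hf (NNReal.coe_lt_coe.1 hx.2)
        (hBr (NNReal.coe_le_coe.1 hx.1)) hc
      refine (h1.mul h2).congr_deriv ?_
      simp only [Real.toNNReal_coe]
      ring) t ⟨NNReal.coe_le_coe.2 hst, le_rfl⟩
  have hgt : g t = P.real (B ∩ {ω | Y t ω = 0}) := by
    have hm : MeasurableSet {ω | Y t ω = 0} := hY.measurable t (measurableSet_singleton 0)
    have : ∀ ω, (0 : ℝ) ^ Y t ω = Set.indicator {ω | Y t ω = 0} 1 ω := fun ω => by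
      simp [Set.indicator_apply, zero_pow_eq]
    simp only [hg, sub_self, neg_zero, Real.exp_zero, Real.toNNReal_coe, this]
    rw [integral_indicator_one hm, measureReal_restrict_apply hm, Set.inter_comm]
  have hgs : g s = ∫ ω in B, (1 - Real.exp (-((t : ℝ) - s))) ^ Y s ω ∂P := by
    simp only [hg, Real.toNNReal_coe]
  rw [← hgt, ← hgs, ← hconst]
  simp [load]

end GeneratingFunction

/-! ### Emptiness probabilities and jumps of paths -/

section Emptiness

variable {Ω : Type*} [MeasurableSpace Ω] {P : Measure Ω} [IsProbabilityMeasure P]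
  {f : ℝ≥0 → ℝ≥0} {Y : ℝ≥0 → Ω → ℕ}

/-- The probability of emptiness when starting from one individual. -/
lemma IsImmigrationDeathProcess.measureReal_eq_zero (hf : Monotone f)
    (hY : IsImmigrationDeathProcess P f Y) (hY0 : ∀ ω, Y 0 ω = 1) (t : ℝ≥0) :
    P.real {ω | Y t ω = 0} =
      Real.exp (-load (fun v => (f v.toNNReal : ℝ)) 0 t) * (1 - Real.exp (-(t : ℝ))) := by
  have h := hY.measureReal_inter_eq_zero hf (zero_le (a := t)) (B := Set.univ) MeasurableSet.univ
  simpa [hY0] using h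

/-- The transition probability from `0` to `0`. -/
lemma IsImmigrationDeathProcess.measureReal_inter_eq_zero_of_subset (hf : Monotone f)
    (hY : IsImmigrationDeathProcess P f Y) {s t : ℝ≥0} (hst : s ≤ t) {B : Set Ω}
    (hB : MeasurableSet[pastFiltration hY.measurable s] B) (hB0 : ∀ ω ∈ B, Y s ω = 0) :
    P.real (B ∩ {ω | Y t ω = 0}) =
      Real.exp (-load (fun v => (f v.toNNReal : ℝ)) s t) * P.real B := by
  rw [hY.measureReal_inter_eq_zero hf hst hB, setIntegral_congr_fun
    ((pastFiltration hY.measurable).le s _ hB) (g := fun _ => (1 : ℝ)) fun ω hω => by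
      simp [hB0 ω hω]]
  simp

lemma measurableSet_pastFiltration_eq_zero (hm : ∀ t, Measurable (Y t)) {s t : ℝ≥0}
    (hst : s ≤ t) : MeasurableSet[pastFiltration hm t] {ω | Y s ω = 0} := by
  have h : MeasurableSpace.comap (Y s) ⊤ ≤ pastFiltration hm t :=
    le_iSup₂_of_le (f := fun j (_ : j ≤ t) => MeasurableSpace.comap (Y j) ⊤) s hst le_rfl
  exact h _ ⟨{0}, trivial, rfl⟩

end Emptiness

section Paths

variable {w : ℝ≥0 → ℕ}

/-- The times at which a path jumps from `0` to `1`. -/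
def zeroOneJumpTimes (w : ℝ≥0 → ℕ) : Set ℝ≥0 :=
  {t | 0 < t ∧ (∀ᶠ s in 𝓝[<] t, w s = 0) ∧ w t = 1}

lemma jumpsZeroOne_eq_top_iff : jumpsZeroOne w = ⊤ ↔ (zeroOneJumpTimes w).Infinite :=
  Set.encard_eq_top_iff

/-- The first time after `s` at which the path is not at `0` is a jump from `0` to `1`. -/
lemma IsBirthDeathPath.exists_jump (hw : IsBirthDeathPath w) {s s' : ℝ≥0} (hss : s ≤ s')
    (hs : w s = 0) (hs' : w s' ≠ 0) : ∃ τ ∈ zeroOneJumpTimes w, s < τ ∧ τ ≤ s' := by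
  set S : Set ℝ≥0 := {u | s ≤ u ∧ w u ≠ 0} with hS
  have hne : S.Nonempty := ⟨s', hss, hs'⟩
  have hbdd : BddBelow S := OrderBot.bddBelow S
  set τ := sInf S with hτ
  have hsτ : s ≤ τ := le_csInf hne fun u hu => hu.1
  have hbefore : ∀ u, s ≤ u → u < τ → w u = 0 := fun u h1 h2 => by
    by_contra h
    exact absurd (csInf_le hbdd (show u ∈ S from ⟨h1, h⟩)) (not_le.2 h2)
  have hwτ : w τ ≠ 0 := by
    intro h0
    obtain ⟨b, hb, hsub⟩ := mem_nhdsGT_iff_exists_Ioo_subset.1 (hw.right_cont τ)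
    have : b ≤ τ := le_csInf hne fun u hu => by
      by_contra hc
      have h1 : τ ≤ u := csInf_le hbdd hu
      rcases h1.eq_or_lt with h | h
      · exact hu.2 (h ▸ h0)
      · exact hu.2 ((hsub ⟨h, not_le.1 hc⟩ : w u = w τ).trans h0)
    exact absurd hb (not_lt.2 this)
  have hlt : s < τ := lt_of_le_of_ne hsτ fun h => hwτ (h ▸ hs)
  have hpos : 0 < τ := (zero_le (a := s)).trans_lt hlt
  have hleft : ∀ᶠ u in 𝓝[<] τ, w u = 0 := by
    filter_upwards [Ioo_mem_nhdsLT hlt] with u hu using hbefore u hu.1.le hu.2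
  refine ⟨τ, ⟨hpos, hleft, ?_⟩, hlt, csInf_le hbdd ⟨hss, hs'⟩⟩
  obtain ⟨n, hn, hj⟩ := hw.left_lim τ hpos
  have : (𝓝[<] τ).NeBot := nhdsLT_neBot_of_exists_lt ⟨s, hlt⟩
  obtain ⟨u, hu1, hu2⟩ := (hn.and hleft).exists
  omega

/-- The path is at `0` at the left end of the `k`-th cell of the grid of mesh `1 / (n + 1)`, and
not at its right end. -/
def LeavesZero (w : ℝ≥0 → ℕ) (n k : ℕ) : Prop :=
  w (k / (n + 1)) = 0 ∧ w ((k + 1) / (n + 1)) ≠ 0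

open Classical in
/-- On fine grids, any given number of jumps from `0` to `1` is detected in distinct cells. -/
lemma IsBirthDeathPath.eventually_le_tsum_leavesZero (hw : IsBirthDeathPath w)
    (h : (zeroOneJumpTimes w).Infinite) (m : ℕ) :
    ∀ᶠ n : ℕ in atTop, (m : ℝ≥0∞) ≤ ∑' k, if LeavesZero w n k then 1 else 0 := by
  obtain ⟨T, hT, hcard⟩ := h.exists_subset_card_eq m
  -- `κ n τ` is the index of the cell `(k / (n + 1), (k + 1) / (n + 1)]` containing `τ`.
  let κ : ℕ → ℝ≥0 → ℕ := fun n τ => ⌈τ * (n + 1)⌉₊ - 1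
  have hκ : ∀ n τ, 0 < τ → (κ n τ : ℝ≥0) / (n + 1) < τ ∧ τ ≤ ((κ n τ : ℝ≥0) + 1) / (n + 1) := by
    intro n τ hτ
    have hp : (0 : ℝ≥0) < n + 1 := n.cast_add_one_pos
    have h1 : 0 < ⌈τ * (n + 1)⌉₊ := Nat.ceil_pos.2 (mul_pos hτ hp)
    have h2 : κ n τ + 1 = ⌈τ * (n + 1)⌉₊ := Nat.sub_add_cancel h1
    constructor
    · rw [div_lt_iff₀ hp]
      exact Nat.lt_ceil.1 (by omega)
    · rw [le_div_iff₀ hp]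
      calc τ * (n + 1) ≤ (⌈τ * (n + 1)⌉₊ : ℝ≥0) := Nat.le_ceil _
        _ = _ := by rw [← h2]; push_cast; rfl
  have hlim : ∀ τ, 0 < τ → Tendsto (fun n : ℕ => (κ n τ : ℝ≥0) / (n + 1)) atTop (𝓝 τ) ∧
      Tendsto (fun n : ℕ => ((κ n τ : ℝ≥0) + 1) / (n + 1)) atTop (𝓝 τ) := by
    intro τ hτ
    have h0 := tendsto_one_div_add_atTop_nhds_zero_nat (𝕜 := ℝ≥0)
    have h1 : Tendsto (fun n : ℕ => τ + 1 / ((n : ℝ≥0) + 1)) atTop (𝓝 τ) := by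
      simpa using tendsto_const_nhds.add h0
    have h2 : Tendsto (fun n : ℕ => τ - 1 / ((n : ℝ≥0) + 1)) atTop (𝓝 τ) := by
      simpa using tendsto_const_nhds.sub h0
    refine ⟨tendsto_of_tendsto_of_tendsto_of_le_of_le h2 tendsto_const_nhds (fun n => ?_)
      fun n => (hκ n τ hτ).1.le,
      tendsto_of_tendsto_of_tendsto_of_le_of_le tendsto_const_nhds h1
      (fun n => (hκ n τ hτ).2) fun n => ?_⟩
    · rw [tsub_le_iff_right, ← add_div]
      exact (hκ n τ hτ).2
    · rw [add_div]
      exact add_le_add_left (hκ n τ hτ).1.le _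
  have e1 : ∀ᶠ n in atTop, ∀ τ ∈ T, LeavesZero w n (κ n τ) := by
    refine (eventually_all_finset T).2 fun τ hτ => ?_
    obtain ⟨hpos, hl, hr⟩ := hT hτ
    have a1 : Tendsto (fun n : ℕ => (κ n τ : ℝ≥0) / (n + 1)) atTop (𝓝[<] τ) :=
      tendsto_nhdsWithin_iff.2 ⟨(hlim τ hpos).1, Eventually.of_forall fun n => (hκ n τ hpos).1⟩
    have a2 : Tendsto (fun n : ℕ => ((κ n τ : ℝ≥0) + 1) / (n + 1)) atTop (𝓝[≥] τ) :=
      tendsto_nhdsWithin_iff.2 ⟨(hlim τ hpos).2, Eventually.of_forall fun n => (hκ n τ hpos).2⟩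
    have hr' : ∀ᶠ s in 𝓝[≥] τ, w s = w τ := by
      rw [← Set.Ioi_union_left, nhdsWithin_union, eventually_sup]
      exact ⟨hw.right_cont τ, by simp⟩
    filter_upwards [a1.eventually hl, a2.eventually hr'] with n h1 h2
    exact ⟨h1, by rw [h2, hr]; exact one_ne_zero⟩
  have e2 : ∀ᶠ n in atTop, ∀ τ ∈ T, ∀ τ' ∈ T, τ ≠ τ' → κ n τ ≠ κ n τ' := by
    refine (eventually_all_finset T).2 fun τ hτ => (eventually_all_finset T).2 fun τ' hτ' => ?_
    by_cases hne : τ = τ'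
    · exact Eventually.of_forall fun n h => absurd hne h
    · rcases lt_or_gt_of_ne hne with h | h
      · filter_upwards [(hlim τ (hT hτ).1).1.eventually_lt (hlim τ' (hT hτ').1).1 h] with n hn _ hc
        exact hn.ne (by rw [hc])
      · filter_upwards [(hlim τ' (hT hτ').1).1.eventually_lt (hlim τ (hT hτ).1).1 h] with n hn _ hc
        exact hn.ne' (by rw [hc])
  filter_upwards [e1, e2] with n h1 h2
  have hinj : Set.InjOn (κ n) T := fun τ hτ τ' hτ' he => by
    by_contra hne
    exact h2 τ hτ τ' hτ' hne he
  calc (m : ℝ≥0∞) = ∑ k ∈ T.image (κ n), if LeavesZero w n k then 1 else 0 := by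
        rw [Finset.sum_image hinj, Finset.sum_congr rfl fun τ hτ => if_pos (h1 τ hτ)]
        simp [hcard]
    _ ≤ _ := ENNReal.sum_le_tsum _

end Paths

/-! ### The convergent case -/

section Convergent

variable {F : ℝ → ℝ}

lemma div_one_add_le_one_sub_exp_neg {x : ℝ} (hx : 0 ≤ x) : x / (1 + x) ≤ 1 - Real.exp (-x) := by
  have h1 : Real.exp (-x) ≤ 1 / (1 + x) := by
    rw [Real.exp_neg, ← one_div]
    exact one_div_le_one_div_of_le (by linarith) (by linarith [Real.add_one_le_exp x])
  have h2 : x / (1 + x) = 1 - 1 / (1 + x) := by field_simp; ring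
  linarith

lemma mul_exp_neg_le_exp_neg_half {x : ℝ} (hx : 0 ≤ x) :
    x * Real.exp (-x) ≤ Real.exp (-(x / 2)) := by
  have h1 : x ≤ Real.exp (x / 2) := by
    have h2 : Real.exp (x / 2) = Real.exp (x / 4) ^ 2 := by
      rw [← Real.exp_nat_mul]; congr 1; push_cast; ring
    have h3 := Real.add_one_le_exp (x / 4)
    nlinarith [sq_nonneg (x / 4 - 1)]
  calc x * Real.exp (-x) ≤ Real.exp (x / 2) * Real.exp (-x) :=
        mul_le_mul_of_nonneg_right h1 (Real.exp_nonneg _)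
    _ = Real.exp (-(x / 2)) := by rw [← Real.exp_add]; congr 1; ring

/-- One step of a grid of mesh `δ ≤ 1`. If the load is within `1` of the rate, then
`load * exp (-load)` is comparable with `rate * exp (-rate)`; otherwise the load grows by at least
`δ / 2`, and the term is dominated by a telescoping one. -/
lemma exp_neg_load_mul_le (hF : Monotone F) (hF0 : ∀ v, 0 ≤ F v) {s δ : ℝ} (hs : 0 ≤ s)
    (hδ0 : 0 ≤ δ) (hδ1 : δ ≤ 1) :
    Real.exp (-load F 0 s) * (1 - Real.exp (-load F s (s + δ))) ≤
      (Real.exp (-load F 0 s) - Real.exp (-load F 0 (s + δ))) +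
      8 * (Real.exp (-(load F 0 s / 2)) - Real.exp (-(load F 0 (s + δ) / 2))) +
      Real.exp 1 * (δ * (F s * Real.exp (-F s))) := by
  set l := load F 0 s with hl
  set l' := load F 0 (s + δ) with hl'
  have hsd : s ≤ s + δ := by linarith
  have hl0 : 0 ≤ l := load_nonneg hF hF0 hs
  have hmono : l ≤ l' := load_mono_right hF hF0 hs hsd
  have hlF : l ≤ F s := load_le_rate hF hF0 hs
  have hsplit : l' = Real.exp (-δ) * l + load F s (s + δ) := by
    have := load_split hF 0 s (s + δ)
    rwa [add_sub_cancel_left] at this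
  have hge : F s * (1 - Real.exp (-δ)) ≤ load F s (s + δ) := by
    have := le_load hF hsd
    rwa [add_sub_cancel_left] at this
  set y := (1 - Real.exp (-δ)) * l with hy
  have hload : load F s (s + δ) = (l' - l) + y := by rw [hy]; linarith
  have hexpδ : 1 - Real.exp (-δ) ≤ δ := by linarith [Real.add_one_le_exp (-δ)]
  have hyl : y ≤ δ * l := mul_le_mul_of_nonneg_right hexpδ hl0
  have hy0 : 0 ≤ y := mul_nonneg (by simpa using hδ0) hl0
  have step1 : Real.exp (-l) * (1 - Real.exp (-load F s (s + δ))) ≤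
      (Real.exp (-l) - Real.exp (-l')) + δ * (l * Real.exp (-l)) := by
    have h1 : Real.exp (-l) * Real.exp (-load F s (s + δ)) = Real.exp (-l') * Real.exp (-y) := by
      rw [← Real.exp_add, ← Real.exp_add, hload]; congr 1; ring
    have h2 : 1 - y ≤ Real.exp (-y) := by linarith [Real.add_one_le_exp (-y)]
    have h3 : Real.exp (-l') * (1 - y) ≤ Real.exp (-l') * Real.exp (-y) :=
      mul_le_mul_of_nonneg_left h2 (Real.exp_nonneg _)
    have h4 : Real.exp (-l') * y ≤ Real.exp (-l) * (δ * l) :=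
      mul_le_mul (Real.exp_le_exp.2 (by linarith)) hyl hy0 (Real.exp_nonneg _)
    linarith
  have hanti : Real.exp (-(l' / 2)) ≤ Real.exp (-(l / 2)) := Real.exp_le_exp.2 (by linarith)
  have step2 : δ * (l * Real.exp (-l)) ≤ 8 * (Real.exp (-(l / 2)) - Real.exp (-(l' / 2))) +
      Real.exp 1 * (δ * (F s * Real.exp (-F s))) := by
    rcases le_or_gt (F s - l) 1 with h | h
    · have h1 : l * Real.exp (-l) ≤ Real.exp 1 * (F s * Real.exp (-F s)) := by
        have h2 : Real.exp (-l) ≤ Real.exp 1 * Real.exp (-F s) := by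
          rw [← Real.exp_add]; exact Real.exp_le_exp.2 (by linarith)
        calc l * Real.exp (-l) ≤ F s * (Real.exp 1 * Real.exp (-F s)) :=
              mul_le_mul hlF h2 (Real.exp_nonneg _) (hF0 s)
          _ = _ := by ring
      have := mul_le_mul_of_nonneg_left h1 hδ0
      linarith
    · have hhalf : δ / 2 ≤ 1 - Real.exp (-δ) :=
        (div_le_div_of_nonneg_left hδ0 (by linarith) (by linarith)).trans
          (div_one_add_le_one_sub_exp_neg hδ0)
      have hgrow : δ / 2 ≤ l' - l := by
        have : 1 * (1 - Real.exp (-δ)) ≤ (F s - l) * (1 - Real.exp (-δ)) :=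
          mul_le_mul_of_nonneg_right h.le (by linarith)
        rw [hy] at hload
        linarith
      have h1 : Real.exp (-(l' / 2)) ≤ Real.exp (-(l / 2)) * Real.exp (-(δ / 4)) := by
        rw [← Real.exp_add]; exact Real.exp_le_exp.2 (by linarith)
      have h2 : δ / 8 ≤ 1 - Real.exp (-(δ / 4)) := by
        refine le_trans ?_ (div_one_add_le_one_sub_exp_neg (by linarith))
        rw [le_div_iff₀ (by linarith)]
        nlinarith
      have h3 : Real.exp (-(l / 2)) * (δ / 8) ≤
          Real.exp (-(l / 2)) * (1 - Real.exp (-(δ / 4))) :=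
        mul_le_mul_of_nonneg_left h2 (Real.exp_nonneg _)
      have h4 := mul_le_mul_of_nonneg_left (mul_exp_neg_le_exp_neg_half hl0) hδ0
      have h5 : 0 ≤ Real.exp 1 * (δ * (F s * Real.exp (-F s))) := by
        have := hF0 s
        positivity
      linarith
  linarith

lemma antitoneOn_one_add_mul_exp_neg :
    AntitoneOn (fun x : ℝ => (1 + x) * Real.exp (-x)) (Set.Ici 0) := by
  intro x hx y _ hxy
  have hx : 0 ≤ x := hx
  have h1 : 1 + y ≤ (1 + x) * Real.exp (y - x) := by
    nlinarith [Real.add_one_le_exp (y - x)]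
  calc (1 + y) * Real.exp (-y) ≤ (1 + x) * Real.exp (y - x) * Real.exp (-y) :=
        mul_le_mul_of_nonneg_right h1 (Real.exp_nonneg _)
    _ = (1 + x) * Real.exp (-x) := by rw [mul_assoc, ← Real.exp_add]; congr 2; ring

/-- Integrability of `F * exp (-F)` bounds its Riemann sums, because `(1 + F) * exp (-F)` is
nonincreasing and is dominated by a multiple of `F * exp (-F)` once `F` is positive. -/
lemma exists_riemannSum_le (hF : Monotone F) (hF0 : ∀ v, 0 ≤ F v)
    (hint : ∫⁻ v in Set.Ici (0 : ℝ), ENNReal.ofReal (Real.exp (-F v) * F v) ≠ ⊤) :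
    ∃ C : ℝ, ∀ δ : ℝ, 0 ≤ δ → δ ≤ 1 → ∀ N : ℕ,
      ∑ k ∈ Finset.range N, δ * (F (k * δ) * Real.exp (-F (k * δ))) ≤ C := by
  by_cases hz : ∀ v, 0 ≤ v → F v = 0
  · refine ⟨0, fun δ hδ _ N => (Finset.sum_eq_zero fun k _ => ?_).le⟩
    rw [hz _ (by positivity)]; simp
  push Not at hz
  obtain ⟨t₀, ht₀, hne⟩ := hz
  have hc : 0 < F t₀ := lt_of_le_of_ne (hF0 t₀) hne.symm
  set h : ℝ → ℝ := fun v => (1 + F v) * Real.exp (-F v) with hh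
  have hanti : Antitone h := fun x y hxy =>
    antitoneOn_one_add_mul_exp_neg (hF0 x) (hF0 y) (hF hxy)
  have hh0 : ∀ v, 0 ≤ h v := fun v =>
    mul_nonneg (by linarith [hF0 v]) (Real.exp_nonneg _)
  have hle1 : ∀ v, h v ≤ 1 := fun v => by
    have := antitoneOn_one_add_mul_exp_neg (Set.mem_Ici.2 le_rfl) (hF0 v) (hF0 v)
    simpa using this
  -- From `t₀` on, `1 + F ≤ a * F`.
  set a : ℝ := 1 + 1 / F t₀ with ha
  have ha0 : 0 ≤ a := by positivity
  have hdom : ∀ v, t₀ ≤ v → h v ≤ a * (Real.exp (-F v) * F v) := by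
    intro v hv
    have h1 : 1 ≤ 1 / F t₀ * F v := by
      rw [one_div, inv_mul_eq_div, one_le_div hc]; exact hF hv
    have h2 : 1 + F v ≤ a * F v := by rw [ha]; linarith
    calc h v ≤ a * F v * Real.exp (-F v) := mul_le_mul_of_nonneg_right h2 (Real.exp_nonneg _)
      _ = _ := by ring
  have hii : ∀ x y : ℝ, IntervalIntegrable h volume x y := fun x y => hanti.intervalIntegrable
  set I := (∫⁻ v in Set.Ici (0 : ℝ), ENNReal.ofReal (Real.exp (-F v) * F v)).toReal with hI
  have hbound : ∀ T : ℝ, 0 ≤ T → ∫ v in (0 : ℝ)..T, h v ≤ t₀ + a * I := by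
    intro T hT
    rw [intervalIntegral.integral_of_le hT, integral_eq_lintegral_of_nonneg_ae
      (Eventually.of_forall hh0) hanti.measurable.aestronglyMeasurable]
    refine ENNReal.toReal_le_of_le_ofReal (by positivity) ?_
    rw [ENNReal.ofReal_add ht₀ (by positivity), ENNReal.ofReal_mul ha0, hI,
      ENNReal.ofReal_toReal hint]
    have hm : Measurable fun v => ENNReal.ofReal (Real.exp (-F v) * F v) :=
      ((Real.measurable_exp.comp hF.measurable.neg).mul hF.measurable).ennreal_ofReal
    have hsub : Set.Ioc 0 T ⊆ Set.Ioc 0 t₀ ∪ Set.Ici t₀ := fun v hv => by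
      rcases le_total v t₀ with h | h
      · exact Or.inl ⟨hv.1, h⟩
      · exact Or.inr h
    calc ∫⁻ v in Set.Ioc 0 T, ENNReal.ofReal (h v)
        ≤ ∫⁻ v in Set.Ioc 0 t₀ ∪ Set.Ici t₀, ENNReal.ofReal (h v) := lintegral_mono_set hsub
      _ ≤ (∫⁻ v in Set.Ioc 0 t₀, ENNReal.ofReal (h v)) +
          ∫⁻ v in Set.Ici t₀, ENNReal.ofReal (h v) := lintegral_union_le _ _ _
      _ ≤ ENNReal.ofReal t₀ + ENNReal.ofReal a *
          ∫⁻ v in Set.Ici (0 : ℝ), ENNReal.ofReal (Real.exp (-F v) * F v) := by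
        refine add_le_add ?_ ?_
        · calc ∫⁻ v in Set.Ioc 0 t₀, ENNReal.ofReal (h v) ≤ ∫⁻ v in Set.Ioc 0 t₀, 1 :=
                lintegral_mono fun v => by
                  rw [← ENNReal.ofReal_one]; exact ENNReal.ofReal_le_ofReal (hle1 v)
            _ = ENNReal.ofReal t₀ := by simp
        · rw [← lintegral_const_mul _ hm]
          calc ∫⁻ v in Set.Ici t₀, ENNReal.ofReal (h v)
              ≤ ∫⁻ v in Set.Ici t₀, ENNReal.ofReal a * ENNReal.ofReal (Real.exp (-F v) * F v) :=
                setLIntegral_mono' measurableSet_Ici fun v hv => by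
                  rw [← ENNReal.ofReal_mul ha0]; exact ENNReal.ofReal_le_ofReal (hdom v hv)
            _ ≤ _ := lintegral_mono_set (Set.Ici_subset_Ici.2 ht₀)
  refine ⟨1 + (t₀ + a * I), fun δ hδ0 hδ1 N => ?_⟩
  have hterm : ∀ v, F v * Real.exp (-F v) ≤ h v := fun v =>
    mul_le_mul_of_nonneg_right (by linarith) (Real.exp_nonneg _)
  cases N with
  | zero =>
    have : 0 ≤ t₀ + a * I := by simpa using hbound 0 le_rfl
    simpa using add_nonneg zero_le_one this
  | succ N =>
    rw [Finset.sum_range_succ', add_comm]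
    refine add_le_add ?_ ?_
    · exact (mul_le_mul hδ1 ((hterm _).trans (hle1 _))
        (mul_nonneg (hF0 _) (Real.exp_nonneg _)) zero_le_one).trans_eq (one_mul 1)
    · refine le_trans ?_ (hbound (N * δ) (by positivity))
      have htel := intervalIntegral.sum_integral_adjacent_intervals (f := h) (μ := volume)
        (a := fun k : ℕ => (k : ℝ) * δ) (n := N) fun k _ => hii _ _
      simp only [Nat.cast_zero, zero_mul] at htel
      rw [← htel]
      refine Finset.sum_le_sum fun k _ => ?_
      have hk : (k : ℝ) * δ ≤ ((k + 1 : ℕ) : ℝ) * δ := by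
        push_cast; linarith
      calc δ * (F ((k + 1 : ℕ) * δ) * Real.exp (-F ((k + 1 : ℕ) * δ)))
          ≤ δ * h ((k + 1 : ℕ) * δ) := mul_le_mul_of_nonneg_left (hterm _) hδ0
        _ = ∫ _ in (k : ℝ) * δ..((k + 1 : ℕ) : ℝ) * δ, h ((k + 1 : ℕ) * δ) := by
          rw [intervalIntegral.integral_const, smul_eq_mul]
          congr 1
          push_cast; ring
        _ ≤ _ := intervalIntegral.integral_mono_on hk intervalIntegrable_const (hii _ _)
          fun v hv => hanti hv.2

/-- The expected number of departures from `0` seen on a grid is bounded uniformly in its mesh. -/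
lemma exists_sum_grid_le (hF : Monotone F) (hF0 : ∀ v, 0 ≤ F v)
    (hint : ∫⁻ v in Set.Ici (0 : ℝ), ENNReal.ofReal (Real.exp (-F v) * F v) ≠ ⊤) :
    ∃ C : ℝ, ∀ δ : ℝ, 0 ≤ δ → δ ≤ 1 → ∀ N : ℕ, ∑ k ∈ Finset.range N,
      Real.exp (-load F 0 (k * δ)) * (1 - Real.exp (-load F (k * δ) ((k + 1 : ℕ) * δ))) ≤ C := by
  obtain ⟨C, hC⟩ := exists_riemannSum_le hF hF0 hint
  refine ⟨1 + 8 + Real.exp 1 * C, fun δ hδ0 hδ1 N => ?_⟩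
  have hterm : ∀ k ∈ Finset.range N, Real.exp (-load F 0 (k * δ)) *
      (1 - Real.exp (-load F (k * δ) ((k + 1 : ℕ) * δ))) ≤
      (Real.exp (-load F 0 (k * δ)) - Real.exp (-load F 0 ((k + 1 : ℕ) * δ))) +
      8 * (Real.exp (-(load F 0 (k * δ) / 2)) - Real.exp (-(load F 0 ((k + 1 : ℕ) * δ) / 2))) +
      Real.exp 1 * (δ * (F (k * δ) * Real.exp (-F (k * δ)))) := fun k _ => by
    have h := exp_neg_load_mul_le hF hF0 (s := k * δ) (by positivity) hδ0 hδ1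
    have e : (k : ℝ) * δ + δ = ((k + 1 : ℕ) : ℝ) * δ := by push_cast; ring
    rwa [e] at h
  refine (Finset.sum_le_sum hterm).trans ?_
  rw [Finset.sum_add_distrib, Finset.sum_add_distrib, ← Finset.mul_sum, ← Finset.mul_sum,
    Finset.sum_range_sub' fun k : ℕ => Real.exp (-load F 0 (k * δ)),
    Finset.sum_range_sub' fun k : ℕ => Real.exp (-(load F 0 (k * δ) / 2))]
  have h0 : load F 0 ((0 : ℕ) * δ) = 0 := by simp [load]
  rw [h0]
  have h1 := mul_le_mul_of_nonneg_left (hC δ hδ0 hδ1 N) (Real.exp_nonneg 1)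
  have h2 := Real.exp_nonneg (-load F 0 (N * δ))
  have h3 := Real.exp_nonneg (-(load F 0 (N * δ) / 2))
  simp only [neg_zero, zero_div, Real.exp_zero]
  linarith

end Convergent

section ConvergentCase

variable {Ω : Type*} [MeasurableSpace Ω] {P : Measure Ω} [IsProbabilityMeasure P]
  {f : ℝ≥0 → ℝ≥0} {Y : ℝ≥0 → Ω → ℕ}

lemma IsImmigrationDeathProcess.measureReal_leavesZero_le (hf : Monotone f)
    (hY : IsImmigrationDeathProcess P f Y) (hY0 : ∀ ω, Y 0 ω = 1) {s t : ℝ≥0} (hst : s ≤ t) :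
    P.real {ω | Y s ω = 0 ∧ Y t ω ≠ 0} ≤
      Real.exp (-load (fun v => (f v.toNNReal : ℝ)) 0 s) *
        (1 - Real.exp (-load (fun v => (f v.toNNReal : ℝ)) s t)) := by
  have hm : ∀ t, MeasurableSet {ω | Y t ω = 0} := fun t =>
    hY.measurable t (measurableSet_singleton 0)
  have h1 := measureReal_sdiff_add_inter (μ := P) (s := {ω | Y s ω = 0}) (hm t)
  have h2 := hY.measureReal_inter_eq_zero_of_subset hf hst
    (measurableSet_pastFiltration_eq_zero hY.measurable le_rfl) (fun ω h => h)
  have h3 : {ω | Y s ω = 0 ∧ Y t ω ≠ 0} = {ω | Y s ω = 0} \ {ω | Y t ω = 0} := rfl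
  have h4 : P.real {ω | Y s ω = 0 ∧ Y t ω ≠ 0} = P.real {ω | Y s ω = 0} *
      (1 - Real.exp (-load (fun v => (f v.toNNReal : ℝ)) s t)) := by
    rw [h3]; linarith
  rw [h4]
  refine mul_le_mul_of_nonneg_right ?_ ?_
  · rw [hY.measureReal_eq_zero hf hY0]
    exact mul_le_of_le_one_right (Real.exp_nonneg _) (one_sub_exp_lt_one _).le
  · have := load_nonneg (monotone_rate hf) (fun v => (f v.toNNReal).coe_nonneg)
      (NNReal.coe_le_coe.2 hst)
    simpa using this

open Classical in
/-- If the integral converges, then the expected number of jumps from `0` to `1` is finite, by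
Fatou's lemma along the grids of mesh `1 / (n + 1)`. -/
theorem IsImmigrationDeathProcess.measure_jumpsZeroOne_eq_top_of_ne_top (hf : Monotone f)
    (hY : IsImmigrationDeathProcess P f Y) (hY0 : ∀ ω, Y 0 ω = 1)
    (hint : ∫⁻ t in Set.Ici (0 : ℝ),
      ENNReal.ofReal (Real.exp (-(f t.toNNReal : ℝ)) * f t.toNNReal) ≠ ⊤) :
    P {ω | jumpsZeroOne (fun t => Y t ω) = ⊤} = 0 := by
  obtain ⟨C, hC⟩ := exists_sum_grid_le (monotone_rate hf)
    (fun v => (f v.toNNReal).coe_nonneg) hint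
  let V : ℕ → Ω → ℝ≥0∞ := fun n ω =>
    ∑' k, if LeavesZero (fun t => Y t ω) n k then 1 else 0
  have hE : ∀ n k, MeasurableSet {ω | LeavesZero (fun t => Y t ω) n k} := fun n k =>
    (hY.measurable _ (measurableSet_singleton 0)).inter
      (hY.measurable _ (measurableSet_singleton 0)).compl
  have hterm : ∀ n k, Measurable fun ω =>
      if LeavesZero (fun t => Y t ω) n k then (1 : ℝ≥0∞) else 0 := fun n k =>
    Measurable.ite (hE n k) measurable_const measurable_const
  have hVm : ∀ n, Measurable (V n) := fun n => Measurable.tsum (hterm n)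
  have hVint : ∀ n, ∫⁻ ω, V n ω ∂P ≤ ENNReal.ofReal C := by
    intro n
    have e : ∫⁻ ω, V n ω ∂P = ∑' k, P {ω | LeavesZero (fun t => Y t ω) n k} := by
      rw [lintegral_tsum fun k => (hterm n k).aemeasurable]
      refine tsum_congr fun k => ?_
      rw [← lintegral_indicator_one (hE n k)]
      rfl
    rw [e]
    refine ENNReal.tsum_le_of_sum_range_le fun N => ?_
    have hδ0 : (0 : ℝ) ≤ 1 / (n + 1) := by positivity
    have hδ1 : (1 : ℝ) / (n + 1) ≤ 1 :=
      (div_le_one (by positivity)).2 (by linarith [n.cast_nonneg (α := ℝ)])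
    refine le_trans ?_ (ENNReal.ofReal_le_ofReal (hC _ hδ0 hδ1 N))
    rw [Finset.sum_congr rfl fun k _ =>
      (ofReal_measureReal (μ := P) (s := {ω | LeavesZero (fun t => Y t ω) n k})).symm,
      ← ENNReal.ofReal_sum_of_nonneg fun _ _ => measureReal_nonneg]
    refine ENNReal.ofReal_le_ofReal (Finset.sum_le_sum fun k _ => ?_)
    have hst : (k : ℝ≥0) / (n + 1) ≤ (k + 1) / (n + 1) := by gcongr; simp
    have h := hY.measureReal_leavesZero_le hf hY0 hst
    have e1 : (((k : ℝ≥0) / (n + 1) : ℝ≥0) : ℝ) = k * (1 / (n + 1)) := by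
      push_cast; ring
    have e2 : ((((k : ℝ≥0) + 1) / (n + 1) : ℝ≥0) : ℝ) = (k + 1 : ℕ) * (1 / (n + 1)) := by
      push_cast; ring
    rw [e1, e2] at h
    exact h
  have hlim : ∫⁻ ω, liminf (fun n => V n ω) atTop ∂P ≠ ⊤ := by
    refine ne_top_of_le_ne_top (ENNReal.ofReal_ne_top (r := C)) ((lintegral_liminf_le hVm).trans ?_)
    exact (liminf_le_liminf (Eventually.of_forall hVint)).trans_eq (liminf_const _)
  have hae := ae_lt_top (.liminf hVm) hlim
  rw [← compl_compl {ω | jumpsZeroOne (fun t => Y t ω) = ⊤}, ← mem_ae_iff]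
  filter_upwards [hae] with ω hω hV
  refine hω.ne (ENNReal.eq_top_of_forall_nnreal_le fun r => ?_)
  obtain ⟨m, hm⟩ := exists_nat_ge r
  refine le_trans (by exact_mod_cast hm) (le_liminf_of_le (by isBoundedDefault)
    ((hY.paths ω).eventually_le_tsum_leavesZero (jumpsZeroOne_eq_top_iff.1 hV) m))

end ConvergentCase

/-! ### Meshes adapted to the birth rate -/

section Mesh

variable {F : ℝ → ℝ}

/-- A sequence of times with steps `1 / F`: at the rate valid at the start of a step, one birth is
expected during the step. -/
def IsRateMesh (F : ℝ → ℝ) (t : ℕ → ℝ≥0) : Prop :=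
  0 < F (t 0) ∧ ∀ k, (t (k + 1) : ℝ) = t k + 1 / F (t k)

lemma IsRateMesh.monotone (hF0 : ∀ v, 0 ≤ F v) {t : ℕ → ℝ≥0} (ht : IsRateMesh F t) :
    Monotone t := by
  refine monotone_nat_of_le_succ fun k => NNReal.coe_le_coe.1 ?_
  rw [ht.2 k]
  have := hF0 (t k)
  have : 0 ≤ 1 / F (t k) := by positivity
  linarith

lemma IsRateMesh.le_rate (hF : Monotone F) (hF0 : ∀ v, 0 ≤ F v) {t : ℕ → ℝ≥0}
    (ht : IsRateMesh F t) (k : ℕ) : F (t 0) ≤ F (t k) :=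
  hF (NNReal.coe_le_coe.2 (ht.monotone hF0 (Nat.zero_le k)))

lemma IsRateMesh.shift (hF : Monotone F) (hF0 : ∀ v, 0 ≤ F v) {t : ℕ → ℝ≥0}
    (ht : IsRateMesh F t) (n : ℕ) : IsRateMesh F fun k => t (n + k) :=
  ⟨ht.1.trans_le (ht.le_rate hF hF0 n), fun k => ht.2 (n + k)⟩

lemma IsRateMesh.tendsto (hF : Monotone F) (hF0 : ∀ v, 0 ≤ F v) {t : ℕ → ℝ≥0}
    (ht : IsRateMesh F t) : Tendsto t atTop atTop := by
  refine (ht.monotone hF0).tendsto_atTop_atTop fun b => ?_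
  by_contra! hb
  have hpos : ∀ k, 0 < F (t k) := fun k => ht.1.trans_le (ht.le_rate hF hF0 k)
  have hbpos : 0 < F b := (hpos 0).trans_le (hF (NNReal.coe_le_coe.2 (hb 0).le))
  -- Steps of a mesh that stays below `b` are at least `1 / F b`.
  have hlow : ∀ k : ℕ, k / F b ≤ t k := by
    intro k
    induction k with
    | zero => simp
    | succ k ih =>
      rw [ht.2 k]
      have h1 : 1 / F b ≤ 1 / F (t k) :=
        one_div_le_one_div_of_le (hpos k) (hF (NNReal.coe_le_coe.2 (hb k).le))
      push_cast
      rw [add_div]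
      linarith
  obtain ⟨k, hk⟩ := exists_nat_gt (b * F b)
  have h1 : (b : ℝ) < k / F b := (lt_div_iff₀ hbpos).2 hk
  exact absurd (NNReal.coe_lt_coe.2 (hb k)) (not_lt.2 (h1.le.trans (hlow k)))

/-- The right-hand side bounds the load of one step of a mesh from below, see `le_load`. -/
lemma le_load_step {c s : ℝ} (hc : 0 < c) (hcs : c ≤ F s) :
    c / (1 + c) ≤ F s * (1 - Real.exp (-(1 / F s))) := by
  have hFs : 0 < F s := hc.trans_le hcs
  have h1 := div_one_add_le_one_sub_exp_neg (x := 1 / F s) (by positivity)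
  calc c / (1 + c) ≤ F s / (1 + F s) := by
        rw [div_le_div_iff₀ (by linarith) (by linarith)]; nlinarith
    _ = F s * (1 / F s / (1 + 1 / F s)) := by field_simp; ring
    _ ≤ _ := mul_le_mul_of_nonneg_left h1 hFs.le

/-- The probability of a return from `0` at time `a` to `0` at time `s` exceeds the unconditional
probability by terms that telescope along a mesh with steps `1 / F`. The parameter `K` measures
how long after time `a` the initial state is forgotten. -/
lemma exp_neg_load_le (hF : Monotone F) (hF0 : ∀ v, 0 ≤ F v) {c a s K : ℝ} (hc : 0 < c)
    (ha : 0 ≤ a) (hca : c ≤ F a) (has : a ≤ s) :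
    Real.exp (-load F a s) ≤ Real.exp (Real.exp (-K)) * Real.exp (-load F 0 s) +
      4 * (1 + c) / c * (Real.exp (-load F a s) - Real.exp (-load F a (s + 1 / F s))) +
      4 * (1 + c) / c * (Real.exp 1 + Real.exp (K / 4)) * (4 + 1 / c) *
        (Real.exp (-((s - a) / 4)) - Real.exp (-((s + 1 / F s - a) / 4))) := by
  have hcs : c ≤ F s := hca.trans (hF has)
  have hFs : 0 < F s := hc.trans_le hcs
  set δ := 1 / F s with hδ
  have hδ0 : 0 < δ := by positivity
  have hδc : δ ≤ 1 / c := one_div_le_one_div_of_le hc hcs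
  set A := 4 * (1 + c) / c with hA
  have hA0 : 0 < A := by positivity
  set g := load F a s with hg
  set g' := load F a (s + δ) with hg'
  set l := load F 0 a with hl
  set u := s - a with hu
  have hu0 : 0 ≤ u := sub_nonneg.2 has
  have hsδ : s ≤ s + δ := by linarith
  have hg0 : 0 ≤ g := load_nonneg hF hF0 has
  have hgg : g ≤ g' := load_mono_right hF hF0 has hsδ
  have hl0 : 0 ≤ l := load_nonneg hF hF0 ha
  have hT1 : 0 ≤ Real.exp (-g) - Real.exp (-g') := by
    linarith [Real.exp_le_exp.2 (neg_le_neg hgg)]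
  have hstep : δ * Real.exp (-(u / 4)) ≤
      (4 + 1 / c) * (Real.exp (-(u / 4)) - Real.exp (-((s + δ - a) / 4))) := by
    have h1 : Real.exp (-((s + δ - a) / 4)) = Real.exp (-(u / 4)) * Real.exp (-(δ / 4)) := by
      rw [← Real.exp_add]; congr 1; rw [hu]; ring
    have h2 := div_one_add_le_one_sub_exp_neg (x := δ / 4) (by positivity)
    have h3 : δ ≤ (4 + 1 / c) * (δ / 4 / (1 + δ / 4)) := by
      have : δ / 4 / (1 + δ / 4) = δ / (4 + δ) := by field_simp
      rw [this, mul_div_assoc', le_div_iff₀ (by linarith)]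
      nlinarith
    have h4 : δ ≤ (4 + 1 / c) * (1 - Real.exp (-(δ / 4))) :=
      h3.trans (mul_le_mul_of_nonneg_left h2 (by positivity))
    rw [h1]
    calc δ * Real.exp (-(u / 4))
        ≤ (4 + 1 / c) * (1 - Real.exp (-(δ / 4))) * Real.exp (-(u / 4)) :=
          mul_le_mul_of_nonneg_right h4 (Real.exp_nonneg _)
      _ = _ := by ring
  have hT2 : 0 ≤ Real.exp (-(u / 4)) - Real.exp (-((s + δ - a) / 4)) := by
    have : Real.exp (-((s + δ - a) / 4)) ≤ Real.exp (-(u / 4)) :=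
      Real.exp_le_exp.2 (by rw [hu]; linarith)
    linarith
  have hT3 : 0 ≤ A * (Real.exp 1 + Real.exp (K / 4)) * (4 + 1 / c) *
      (Real.exp (-(u / 4)) - Real.exp (-((s + δ - a) / 4))) :=
    mul_nonneg (by positivity) hT2
  rcases le_or_gt u (l + K) with hcase | hcase
  · -- Shortly after time `a`: either the load increases by a definite amount in this step, or
    -- it is so large that the return is unlikely.
    have hA1 : Real.exp (-g) ≤ A * (Real.exp (-g) - Real.exp (-g')) +
        A * (δ * (g * Real.exp (-g))) := by
      have hsplit : g' = Real.exp (-δ) * g + load F s (s + δ) := by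
        have := load_split hF a s (s + δ)
        rwa [add_sub_cancel_left] at this
      have h1 : c / (1 + c) ≤ load F s (s + δ) := by
        refine (le_load_step hc hcs).trans ?_
        have := le_load hF hsδ
        rwa [add_sub_cancel_left] at this
      have h2 : (1 - δ) * g ≤ Real.exp (-δ) * g :=
        mul_le_mul_of_nonneg_right (by linarith [Real.add_one_le_exp (-δ)]) hg0
      set c' := c / (1 + c) with hc'
      have hc'0 : 0 < c' := by positivity
      have hc'1 : c' ≤ 1 := (div_le_one (by linarith)).2 (by linarith)
      have hAc : A = 4 / c' := by rw [hA, hc']; field_simp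
      rcases le_or_gt (c' / 2) (δ * g) with h | h
      · have h3 : 1 ≤ A * (δ * g) := by
          rw [hAc, div_mul_eq_mul_div, le_div_iff₀ hc'0]; linarith
        have h4 := mul_le_mul_of_nonneg_right h3 (Real.exp_nonneg (-g))
        have h5 := mul_nonneg hA0.le hT1
        linarith
      · have h3 : c' / 2 ≤ g' - g := by linarith
        have h4 : Real.exp (-g') ≤ Real.exp (-g) * Real.exp (-(c' / 2)) := by
          rw [← Real.exp_add]; exact Real.exp_le_exp.2 (by linarith)
        have h5 : c' / 4 ≤ 1 - Real.exp (-(c' / 2)) := by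
          refine le_trans ?_ (div_one_add_le_one_sub_exp_neg (by linarith))
          rw [le_div_iff₀ (by linarith)]
          nlinarith
        have h6 : Real.exp (-g) * (c' / 4) ≤ Real.exp (-g) - Real.exp (-g') := by
          have := mul_le_mul_of_nonneg_left h5 (Real.exp_nonneg (-g))
          linarith
        have h7 : Real.exp (-g) ≤ A * (Real.exp (-g) - Real.exp (-g')) := by
          rw [hAc, div_mul_eq_mul_div, le_div_iff₀ hc'0]; linarith
        have h8 : 0 ≤ A * (δ * (g * Real.exp (-g))) := by positivity
        linarith
    have hB : g * Real.exp (-g) ≤ (Real.exp 1 + Real.exp (K / 4)) * Real.exp (-(u / 4)) := by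
      refine (mul_exp_neg_le_exp_neg_half hg0).trans ?_
      rw [add_mul, ← Real.exp_add, ← Real.exp_add]
      rcases le_or_gt u 1 with h | h
      · have h1 : Real.exp (-(g / 2)) ≤ Real.exp (1 + -(u / 4)) :=
          Real.exp_le_exp.2 (by linarith)
        linarith [Real.exp_nonneg (K / 4 + -(u / 4))]
      · have h1 : Real.exp (-u) ≤ 1 / 2 := by
          have := div_one_add_le_one_sub_exp_neg hu0
          have h2 : 1 / 2 ≤ u / (1 + u) := by
            rw [div_le_div_iff₀ (by norm_num) (by linarith)]; linarith
          linarith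
        have h2 : l / 2 ≤ g := by
          have h3 := le_load hF has
          have h4 : l * (1 / 2) ≤ F a * (1 - Real.exp (-u)) :=
            mul_le_mul (load_le_rate hF hF0 ha) (by linarith) (by norm_num) (hF0 a)
          linarith
        have h3 : Real.exp (-(g / 2)) ≤ Real.exp (K / 4 + -(u / 4)) :=
          Real.exp_le_exp.2 (by linarith)
        linarith [Real.exp_nonneg (1 + -(u / 4))]
    have hC : A * (δ * (g * Real.exp (-g))) ≤
        A * (Real.exp 1 + Real.exp (K / 4)) * (4 + 1 / c) *
          (Real.exp (-(u / 4)) - Real.exp (-((s + δ - a) / 4))) := by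
      calc A * (δ * (g * Real.exp (-g)))
          ≤ A * (δ * ((Real.exp 1 + Real.exp (K / 4)) * Real.exp (-(u / 4)))) := by gcongr
        _ = A * (Real.exp 1 + Real.exp (K / 4)) * (δ * Real.exp (-(u / 4))) := by ring
        _ ≤ A * (Real.exp 1 + Real.exp (K / 4)) *
            ((4 + 1 / c) * (Real.exp (-(u / 4)) - Real.exp (-((s + δ - a) / 4)))) := by gcongr
        _ = _ := by ring
    have hD : 0 ≤ Real.exp (Real.exp (-K)) * Real.exp (-load F 0 s) := by positivity
    linarith
  · -- Later, the load at time `a` has been forgotten up to `exp (-K)`.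
    have hsplit : load F 0 s = Real.exp (-u) * l + g := load_split hF 0 a s
    have h1 : Real.exp (-u) * l ≤ Real.exp (-K) := by
      have h2 : l ≤ Real.exp l := by linarith [Real.add_one_le_exp l]
      calc Real.exp (-u) * l ≤ Real.exp (-(l + K)) * Real.exp l := by
            gcongr
        _ = Real.exp (-K) := by rw [← Real.exp_add]; congr 1; ring
    have h2 : Real.exp (-g) ≤ Real.exp (Real.exp (-K)) * Real.exp (-load F 0 s) := by
      rw [← Real.exp_add]; exact Real.exp_le_exp.2 (by linarith)
    have h3 := mul_nonneg hA0.le hT1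
    linarith

/-- Sum of return probabilities along the mesh. -/
lemma IsRateMesh.exists_sum_exp_neg_load_le (hF : Monotone F) (hF0 : ∀ v, 0 ≤ F v) {t : ℕ → ℝ≥0}
    (ht : IsRateMesh F t) (K : ℝ) :
    ∃ C : ℝ, 0 ≤ C ∧ ∀ j M : ℕ, j ≤ M → ∑ k ∈ Finset.Ico j M, Real.exp (-load F (t j) (t k)) ≤
      C + Real.exp (Real.exp (-K)) * ∑ k ∈ Finset.range M, Real.exp (-load F 0 (t k)) := by
  set c := F (t 0) with hc
  have hc0 : 0 < c := ht.1
  set A := 4 * (1 + c) / c with hA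
  have hA0 : 0 < A := by positivity
  set C₁ := A * (Real.exp 1 + Real.exp (K / 4)) * (4 + 1 / c) with hC₁
  have hC0 : 0 < C₁ := by positivity
  refine ⟨A + C₁, by positivity, fun j M hjM => ?_⟩
  have hterm : ∀ k ∈ Finset.Ico j M, Real.exp (-load F (t j) (t k)) ≤
      Real.exp (Real.exp (-K)) * Real.exp (-load F 0 (t k)) +
      A * (Real.exp (-load F (t j) (t k)) - Real.exp (-load F (t j) (t (k + 1)))) +
      C₁ * (Real.exp (-(((t k : ℝ) - t j) / 4)) - Real.exp (-(((t (k + 1) : ℝ) - t j) / 4))) := by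
    intro k hk
    rw [ht.2 k]
    exact exp_neg_load_le hF hF0 hc0 (t j).coe_nonneg (ht.le_rate hF hF0 j)
      (NNReal.coe_le_coe.2 (ht.monotone hF0 (Finset.mem_Ico.1 hk).1))
  refine (Finset.sum_le_sum hterm).trans ?_
  rw [Finset.sum_add_distrib, Finset.sum_add_distrib, ← Finset.mul_sum, ← Finset.mul_sum,
    ← Finset.mul_sum]
  have htel : ∀ h : ℕ → ℝ, ∑ k ∈ Finset.Ico j M, (h k - h (k + 1)) = h j - h M := fun h => by
    have := Finset.sum_Ico_sub h hjM
    rw [← neg_sub (h M), ← this, ← Finset.sum_neg_distrib]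
    simp
  rw [htel fun k => Real.exp (-load F (t j) (t k)),
    htel fun k => Real.exp (-(((t k : ℝ) - t j) / 4))]
  have e1 : Real.exp (-load F (t j) (t j)) = 1 := by simp [load]
  have e2 : Real.exp (-(((t j : ℝ) - t j) / 4)) = 1 := by simp
  rw [e1, e2]
  have h1 : A * (1 - Real.exp (-load F (t j) (t M))) ≤ A :=
    mul_le_of_le_one_right hA0.le (one_sub_exp_lt_one _).le
  have h2 : C₁ * (1 - Real.exp (-(((t M : ℝ) - t j) / 4))) ≤ C₁ :=
    mul_le_of_le_one_right hC0.le (one_sub_exp_lt_one _).le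
  have h3 : ∑ k ∈ Finset.Ico j M, Real.exp (-load F 0 (t k)) ≤
      ∑ k ∈ Finset.range M, Real.exp (-load F 0 (t k)) := by
    refine Finset.sum_le_sum_of_subset_of_nonneg (fun k hk => ?_) fun k _ _ => Real.exp_nonneg _
    exact Finset.mem_range.2 (Finset.mem_Ico.1 hk).2
  have h4 := mul_le_mul_of_nonneg_left h3 (Real.exp_nonneg (Real.exp (-K)))
  linarith

/-- Divergence of the integral makes the expected number of visits to `0` along the mesh
infinite. -/
lemma IsRateMesh.tendsto_sum_exp_neg_load (hF : Monotone F) (hF0 : ∀ v, 0 ≤ F v) {t : ℕ → ℝ≥0}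
    (ht : IsRateMesh F t)
    (hint : ∫⁻ v in Set.Ici (0 : ℝ), ENNReal.ofReal (Real.exp (-F v) * F v) = ⊤) :
    Tendsto (fun M => ∑ k ∈ Finset.range M, Real.exp (-load F 0 (t k))) atTop atTop := by
  set c := F (t 0) with hc
  have hc0 : 0 < c := ht.1
  have hpos : ∀ k, 0 < F (t k) := fun k => ht.1.trans_le (ht.le_rate hF hF0 k)
  have hmono := ht.monotone hF0
  refine (not_summable_iff_tendsto_nat_atTop_of_nonneg fun k => Real.exp_nonneg _).1 fun hs => ?_
  have hs' : Summable fun k => (1 + 1 / c) * Real.exp (-load F 0 (t k)) := hs.mul_left _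
  have hcell : ∀ k, ∫⁻ v in Set.Ico (t k : ℝ) (t (k + 1)),
      ENNReal.ofReal (Real.exp (-F v) * F v) ≤
        ENNReal.ofReal ((1 + 1 / c) * Real.exp (-load F 0 (t k))) := by
    intro k
    have hb : ∀ v ∈ Set.Ico (t k : ℝ) (t (k + 1)), ENNReal.ofReal (Real.exp (-F v) * F v) ≤
        ENNReal.ofReal ((1 + F (t k)) * Real.exp (-F (t k))) := fun v hv => by
      refine ENNReal.ofReal_le_ofReal ?_
      have h1 := antitoneOn_one_add_mul_exp_neg (hF0 (t k)) (hF0 v) (hF hv.1)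
      have h2 := Real.exp_nonneg (-F v)
      simp only at h1
      linarith
    refine (setLIntegral_mono' measurableSet_Ico hb).trans ?_
    rw [setLIntegral_const, Real.volume_Ico, ht.2 k, add_sub_cancel_left,
      ← ENNReal.ofReal_mul (mul_nonneg (by linarith [hF0 (t k)]) (Real.exp_nonneg _))]
    refine ENNReal.ofReal_le_ofReal ?_
    have h1 : (1 + F (t k)) * (1 / F (t k)) ≤ 1 + 1 / c := by
      have h2 : 1 / F (t k) ≤ 1 / c := one_div_le_one_div_of_le hc0 (ht.le_rate hF hF0 k)
      have h3 : (1 + F (t k)) * (1 / F (t k)) = 1 + 1 / F (t k) := by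
        have := (hpos k).ne'
        field_simp
        ring
      linarith
    have h2 : Real.exp (-F (t k)) ≤ Real.exp (-load F 0 (t k)) :=
      Real.exp_le_exp.2 (neg_le_neg (load_le_rate hF hF0 (t k).coe_nonneg))
    calc (1 + F (t k)) * Real.exp (-F (t k)) * (1 / F (t k))
        = (1 + F (t k)) * (1 / F (t k)) * Real.exp (-F (t k)) := by ring
      _ ≤ _ := mul_le_mul h1 h2 (Real.exp_nonneg _) (by positivity)
  have hcover : Set.Ici (0 : ℝ) ⊆ Set.Ico 0 (t 0 : ℝ) ∪ ⋃ k, Set.Ico (t k : ℝ) (t (k + 1)) := by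
    intro v hv
    rcases lt_or_ge v (t 0) with h | h
    · exact Or.inl ⟨hv, h⟩
    · refine Or.inr (Set.mem_iUnion.2 ?_)
      have hex : ∃ k, v < t k := by
        obtain ⟨k, hk⟩ := ((NNReal.tendsto_coe_atTop.2 (ht.tendsto hF hF0)).eventually_gt_atTop
          v).exists
        exact ⟨k, hk⟩
      classical
      have h0 : Nat.find hex ≠ 0 := fun h0 => by
        have := Nat.find_spec hex
        rw [h0] at this
        exact absurd this (not_lt.2 h)
      obtain ⟨k, hk⟩ := Nat.exists_eq_succ_of_ne_zero h0
      refine ⟨k, ?_, ?_⟩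
      · exact not_lt.1 (Nat.find_min hex (m := k) (by omega))
      · have := Nat.find_spec hex
        rwa [hk] at this
  have hstart : ∫⁻ v in Set.Ico 0 (t 0 : ℝ), ENNReal.ofReal (Real.exp (-F v) * F v) ≠ ⊤ := by
    have hb : ∀ v ∈ Set.Ico 0 (t 0 : ℝ), ENNReal.ofReal (Real.exp (-F v) * F v) ≤ 1 := by
      intro v _
      rw [← ENNReal.ofReal_one]
      refine ENNReal.ofReal_le_ofReal ?_
      have := antitoneOn_one_add_mul_exp_neg (Set.mem_Ici.2 le_rfl) (hF0 v) (hF0 v)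
      simp only [add_zero, neg_zero, Real.exp_zero, mul_one] at this
      linarith [Real.exp_nonneg (-F v)]
    refine ne_top_of_le_ne_top ?_ (setLIntegral_mono' measurableSet_Ico hb)
    simp
  refine absurd hint (ne_top_of_le_ne_top (ENNReal.add_ne_top.2 ⟨hstart, hs'.tsum_ofReal_ne_top⟩)
    ?_)
  calc ∫⁻ v in Set.Ici (0 : ℝ), ENNReal.ofReal (Real.exp (-F v) * F v)
      ≤ ∫⁻ v in Set.Ico 0 (t 0 : ℝ) ∪ ⋃ k, Set.Ico (t k : ℝ) (t (k + 1)),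
          ENNReal.ofReal (Real.exp (-F v) * F v) := lintegral_mono_set hcover
    _ ≤ (∫⁻ v in Set.Ico 0 (t 0 : ℝ), ENNReal.ofReal (Real.exp (-F v) * F v)) +
        ∫⁻ v in ⋃ k, Set.Ico (t k : ℝ) (t (k + 1)), ENNReal.ofReal (Real.exp (-F v) * F v) :=
      lintegral_union_le _ _ _
    _ ≤ _ := by
      gcongr
      exact (lintegral_iUnion_le _ _).trans (ENNReal.tsum_le_tsum hcell)

end Mesh

/-! ### The divergent case -/

section DivergentCase

variable {Ω : Type*} [MeasurableSpace Ω] {P : Measure Ω} [IsProbabilityMeasure P]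
  {f : ℝ≥0 → ℝ≥0} {Y : ℝ≥0 → Ω → ℕ}

lemma exists_isRateMesh {F : ℝ → ℝ} (hF0 : ∀ v, 0 ≤ F v) {s : ℝ≥0} (hs : 0 < F s) :
    ∃ t : ℕ → ℝ≥0, IsRateMesh F t := by
  refine ⟨fun n => Nat.rec s (fun _ x => x + (1 / F x).toNNReal) n, hs, fun k => ?_⟩
  dsimp only
  rw [NNReal.coe_add, Real.coe_toNNReal _ (div_nonneg zero_le_one (hF0 _))]

/-- First-entrance decomposition: the expected number of visits to `0` among the first `M` points
of the mesh is at most the probability of such a visit times the largest expected number of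
visits counted from a visit on. -/
lemma IsImmigrationDeathProcess.sum_measureReal_eq_zero_le (hf : Monotone f)
    (hY : IsImmigrationDeathProcess P f Y) {t : ℕ → ℝ≥0} (ht : Monotone t) {W : ℝ}
    (hW0 : 0 ≤ W) {M : ℕ}
    (hW : ∀ j < M, ∑ k ∈ Finset.Ico j M,
      Real.exp (-load (fun v => (f v.toNNReal : ℝ)) (t j) (t k)) ≤ W) :
    ∑ k ∈ Finset.range M, P.real {ω | Y (t k) ω = 0} ≤
      P.real (⋃ k, {ω | Y (t k) ω = 0}) * W := by
  set D : ℕ → Set Ω := fun k => {ω | Y (t k) ω = 0} with hD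
  set B : ℕ → Set Ω := disjointed D with hB
  have hBF : ∀ j, MeasurableSet[pastFiltration hY.measurable (t j)] (B j) := by
    intro j
    rw [hB, disjointed_eq_inter_compl]
    refine (measurableSet_pastFiltration_eq_zero hY.measurable le_rfl).inter
      (MeasurableSet.iInter fun i => MeasurableSet.iInter fun hi => ?_)
    exact (measurableSet_pastFiltration_eq_zero hY.measurable (ht (le_of_lt hi))).compl
  have hBm : ∀ j, MeasurableSet (B j) := fun j => (pastFiltration hY.measurable).le _ _ (hBF j)
  have hBD : ∀ j, B j ⊆ D j := fun j => disjointed_subset D j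
  have h1 : ∀ k, P.real (D k) ≤ ∑ j ∈ Finset.range (k + 1),
      Real.exp (-load (fun v => (f v.toNNReal : ℝ)) (t j) (t k)) * P.real (B j) := by
    intro k
    have hsub : D k ⊆ ⋃ j ∈ Finset.range (k + 1), B j ∩ D k := by
      intro ω hω
      have hmem : ω ∈ partialSups D k := le_partialSups D k hω
      rw [← biUnion_range_succ_disjointed] at hmem
      obtain ⟨j, hj, hjω⟩ := Set.mem_iUnion₂.1 hmem
      exact Set.mem_iUnion₂.2 ⟨j, hj, hjω, hω⟩
    refine (measureReal_mono hsub (measure_ne_top P _)).trans ((measureReal_biUnion_finset_le _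
        _).trans ?_)
    refine Finset.sum_le_sum fun j hj => (hY.measureReal_inter_eq_zero_of_subset hf
      (ht (Nat.lt_succ_iff.1 (Finset.mem_range.1 hj))) (hBF j) fun ω h => hBD j h).le
  calc ∑ k ∈ Finset.range M, P.real (D k)
      ≤ ∑ k ∈ Finset.range M, ∑ j ∈ Finset.range (k + 1),
          Real.exp (-load (fun v => (f v.toNNReal : ℝ)) (t j) (t k)) * P.real (B j) :=
        Finset.sum_le_sum fun k _ => h1 k
    _ = ∑ j ∈ Finset.range M, ∑ k ∈ Finset.Ico j M,
          Real.exp (-load (fun v => (f v.toNNReal : ℝ)) (t j) (t k)) * P.real (B j) := by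
        refine Finset.sum_comm' fun k j => ?_
        simp only [Finset.mem_range, Finset.mem_Ico]
        omega
    _ ≤ ∑ j ∈ Finset.range M, P.real (B j) * W := by
        refine Finset.sum_le_sum fun j hj => ?_
        rw [← Finset.sum_mul, mul_comm]
        exact mul_le_mul_of_nonneg_left (hW j (Finset.mem_range.1 hj)) measureReal_nonneg
    _ = P.real (⋃ j ∈ Finset.range M, B j) * W := by
        rw [← Finset.sum_mul, measureReal_biUnion_finset
          (fun i _ j _ hij => disjoint_disjointed D hij) fun j _ => hBm j]
    _ ≤ P.real (⋃ k, D k) * W := by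
        refine mul_le_mul_of_nonneg_right (measureReal_mono ?_) hW0
        exact Set.iUnion₂_subset fun j _ => (hBD j).trans (Set.subset_iUnion D j)

/-- A mesh that starts late is visited at `0` with probability close to one. -/
lemma IsImmigrationDeathProcess.le_measureReal_iUnion_eq_zero (hf : Monotone f)
    (hY : IsImmigrationDeathProcess P f Y) (hY0 : ∀ ω, Y 0 ω = 1)
    (hint : ∫⁻ t in Set.Ici (0 : ℝ),
      ENNReal.ofReal (Real.exp (-(f t.toNNReal : ℝ)) * f t.toNNReal) = ⊤)
    {t : ℕ → ℝ≥0} (ht : IsRateMesh (fun v => (f v.toNNReal : ℝ)) t) :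
    1 - Real.exp (-(t 0 : ℝ)) ≤ P.real (⋃ k, {ω | Y (t k) ω = 0}) := by
  set F : ℝ → ℝ := fun v => (f v.toNNReal : ℝ) with hFdef
  have hF : Monotone F := monotone_rate hf
  have hF0 : ∀ v, 0 ≤ F v := fun v => (f v.toNNReal).coe_nonneg
  have hmono := ht.monotone hF0
  set p := P.real (⋃ k, {ω | Y (t k) ω = 0}) with hp
  have hp0 : 0 ≤ p := measureReal_nonneg
  have hS := ht.tendsto_sum_exp_neg_load hF hF0 hint
  -- Divide the first-entrance inequality by the divergent sum.
  have hK : ∀ K : ℝ, 1 - Real.exp (-(t 0 : ℝ)) ≤ p * Real.exp (Real.exp (-K)) := by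
    intro K
    obtain ⟨C, hC0, hC⟩ := ht.exists_sum_exp_neg_load_le hF hF0 K
    by_contra! hlt
    set η := 1 - Real.exp (-(t 0 : ℝ)) - p * Real.exp (Real.exp (-K)) with hη
    have hη0 : 0 < η := sub_pos.2 hlt
    obtain ⟨M, hM⟩ := (hS.eventually_gt_atTop (p * C / η)).exists
    rw [div_lt_iff₀ hη0] at hM
    have h1 := hY.sum_measureReal_eq_zero_le hf hmono (add_nonneg hC0 (mul_nonneg
      (Real.exp_nonneg _) (Finset.sum_nonneg fun k _ => Real.exp_nonneg _))) fun j (hj : j < M) =>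
          hC j M hj.le
    have h2 : (1 - Real.exp (-(t 0 : ℝ))) * ∑ k ∈ Finset.range M, Real.exp (-load F 0 (t k)) ≤
        ∑ k ∈ Finset.range M, P.real {ω | Y (t k) ω = 0} := by
      rw [Finset.mul_sum]
      refine Finset.sum_le_sum fun k _ => ?_
      rw [hY.measureReal_eq_zero hf hY0, mul_comm]
      refine mul_le_mul_of_nonneg_left ?_ (Real.exp_nonneg _)
      have := Real.exp_le_exp.2 (neg_le_neg (NNReal.coe_le_coe.2 (hmono (Nat.zero_le k))))
      linarith
    have h3 := h2.trans h1
    rw [hη] at hM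
    linarith
  have hlim : Tendsto (fun K : ℝ => p * Real.exp (Real.exp (-K))) atTop (𝓝 p) := by
    have : Tendsto (fun K : ℝ => Real.exp (Real.exp (-K))) atTop (𝓝 (Real.exp 0)) :=
      (Real.continuous_exp.tendsto 0).comp (Real.tendsto_exp_neg_atTop_nhds_zero)
    simpa using this.const_mul p
  exact ge_of_tendsto hlim (Eventually.of_forall hK)

/-- The process is almost surely not at `0` at all points of a mesh, since it leaves `0` during
each step with probability bounded below. -/
lemma IsImmigrationDeathProcess.measure_iInter_eq_zero (hf : Monotone f)
    (hY : IsImmigrationDeathProcess P f Y) {t : ℕ → ℝ≥0}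
    (ht : IsRateMesh (fun v => (f v.toNNReal : ℝ)) t) :
    P (⋂ k, {ω | Y (t k) ω = 0}) = 0 := by
  set F : ℝ → ℝ := fun v => (f v.toNNReal : ℝ) with hFdef
  have hF : Monotone F := monotone_rate hf
  have hF0 : ∀ v, 0 ≤ F v := fun v => (f v.toNNReal).coe_nonneg
  have hmono := ht.monotone hF0
  set c := F (t 0) / (1 + F (t 0)) with hc
  have hc0 : 0 < c := div_pos ht.1 (by linarith [ht.1])
  let A : ℕ → Set Ω := fun m => ⋂ k ≤ m, {ω | Y (t k) ω = 0}
  have hA : ∀ m, MeasurableSet[pastFiltration hY.measurable (t m)] (A m) := fun m =>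
    MeasurableSet.iInter fun k => MeasurableSet.iInter fun hk =>
      measurableSet_pastFiltration_eq_zero hY.measurable (hmono hk)
  have hstep : ∀ k, c ≤ load F (t k) (t (k + 1)) := fun k => by
    have h1 := le_load hF (NNReal.coe_le_coe.2 (hmono k.le_succ))
    rw [ht.2 k, add_sub_cancel_left] at h1
    rw [ht.2 k]
    exact (le_load_step ht.1 (ht.le_rate hF hF0 k)).trans h1
  have hbound : ∀ m, P.real (A m) ≤ Real.exp (-c) ^ m := by
    intro m
    induction m with
    | zero => simp
    | succ m ih =>
      have hsub : A (m + 1) ⊆ A m ∩ {ω | Y (t (m + 1)) ω = 0} := fun ω hω => by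
        simp only [A, Set.mem_iInter] at hω ⊢
        exact ⟨Set.mem_iInter₂.2 fun k hk => hω k (by omega), hω (m + 1) le_rfl⟩
      refine (measureReal_mono hsub).trans ?_
      rw [hY.measureReal_inter_eq_zero_of_subset hf (hmono m.le_succ) (hA m)
        fun ω hω => Set.mem_iInter₂.1 hω m le_rfl, pow_succ']
      exact mul_le_mul (Real.exp_le_exp.2 (neg_le_neg (hstep m))) ih measureReal_nonneg
        (Real.exp_nonneg _)
  have hlim : Tendsto (fun m : ℕ => Real.exp (-c) ^ m) atTop (𝓝 0) :=
    tendsto_pow_atTop_nhds_zero_of_lt_one (Real.exp_nonneg _)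
      (Real.exp_lt_one_iff.2 (neg_lt_zero.2 hc0))
  have h0 : P.real (⋂ k, {ω | Y (t k) ω = 0}) ≤ 0 :=
    ge_of_tendsto hlim (Eventually.of_forall fun m => (measureReal_mono
      (Set.subset_iInter₂ fun k _ => Set.iInter_subset _ k)).trans (hbound m))
  exact (measureReal_eq_zero_iff (by finiteness)).1 (le_antisymm h0 measureReal_nonneg)

lemma IsBirthDeathPath.jumpsZeroOne_eq_top {w : ℝ≥0 → ℕ} (hw : IsBirthDeathPath w) {t : ℕ → ℝ≥0}
    (ht : Monotone t) (h0 : ∃ᶠ k in atTop, w (t k) = 0) (h1 : ∃ᶠ k in atTop, w (t k) ≠ 0) :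
    jumpsZeroOne w = ⊤ := by
  set S : Set ℕ := {k | w (t k) = 0 ∧ w (t (k + 1)) ≠ 0} with hS
  have hinf : S.Infinite := by
    refine Nat.frequently_atTop_iff_infinite.1 (frequently_atTop.2 fun n => ?_)
    by_contra! hc
    obtain ⟨k, hk, hk0⟩ := frequently_atTop.1 h0 n
    have hall : ∀ l, k ≤ l → w (t l) = 0 := fun l hl => by
      induction l, hl using Nat.le_induction with
      | base => exact hk0
      | succ l hl ih =>
        exact hc l (hk.trans hl) ih
    obtain ⟨l, hl, hl0⟩ := frequently_atTop.1 h1 k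
    exact hl0 (hall l hl)
  rw [jumpsZeroOne_eq_top_iff]
  have hex : ∀ k : S, ∃ τ ∈ zeroOneJumpTimes w, t k < τ ∧ τ ≤ t (k + 1) := fun k =>
    hw.exists_jump (ht (Nat.le_succ _)) k.2.1 k.2.2
  choose τ hτ hlt hle using hex
  have : Infinite S := hinf.to_subtype
  refine Set.infinite_of_injective_forall_mem (f := τ) (fun k l hkl => ?_) hτ
  by_contra hne
  rcases lt_or_gt_of_ne (fun h => hne (Subtype.ext h) : (k : ℕ) ≠ l) with h | h
  · exact absurd hkl (((hle k).trans (ht h)).trans_lt (hlt l)).ne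
  · exact absurd hkl (((hle l).trans (ht h)).trans_lt (hlt k)).ne'

/-- If the integral diverges, then almost surely the process is at `0` at infinitely many points
of a mesh and leaves `0` infinitely often. -/
theorem IsImmigrationDeathProcess.measure_jumpsZeroOne_eq_top_of_eq_top (hf : Monotone f)
    (hY : IsImmigrationDeathProcess P f Y) (hY0 : ∀ ω, Y 0 ω = 1)
    (hint : ∫⁻ t in Set.Ici (0 : ℝ),
      ENNReal.ofReal (Real.exp (-(f t.toNNReal : ℝ)) * f t.toNNReal) = ⊤) :
    P {ω | jumpsZeroOne (fun t => Y t ω) = ⊤} = 1 := by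
  set F : ℝ → ℝ := fun v => (f v.toNNReal : ℝ) with hFdef
  have hF : Monotone F := monotone_rate hf
  have hF0 : ∀ v, 0 ≤ F v := fun v => (f v.toNNReal).coe_nonneg
  have hex : ∃ s : ℝ≥0, 0 < F s := by
    by_contra! h
    have hz : ∀ v : ℝ, (f v.toNNReal : ℝ) = 0 := fun v =>
      le_antisymm (by simpa only [hFdef, Real.toNNReal_coe] using h v.toNNReal) (f
          v.toNNReal).coe_nonneg
    simp [hz] at hint
  obtain ⟨s, hs⟩ := hex
  obtain ⟨t, ht⟩ := exists_isRateMesh hF0 hs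
  have hmono := ht.monotone hF0
  let U : ℕ → Set Ω := fun n => ⋃ k, {ω | Y (t (n + k)) ω = 0}
  have hUm : ∀ n, MeasurableSet (U n) := fun n =>
    MeasurableSet.iUnion fun k => hY.measurable _ (measurableSet_singleton 0)
  have hUanti : ∀ n m, U (n + m) ⊆ U n := fun n m ω hω => by
    obtain ⟨k, hk⟩ := Set.mem_iUnion.1 hω
    exact Set.mem_iUnion.2 ⟨m + k, by rwa [← add_assoc]⟩
  have hU : ∀ n, P (U n) = 1 := by
    intro n
    have h1 : ∀ m, 1 - Real.exp (-(t (n + m) : ℝ)) ≤ P.real (U n) := fun m =>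
      (hY.le_measureReal_iUnion_eq_zero hf hY0 hint (ht.shift hF hF0 (n + m))).trans
        (measureReal_mono (hUanti n m))
    have h2 : Tendsto (fun m => 1 - Real.exp (-(t (n + m) : ℝ))) atTop (𝓝 (1 - 0)) := by
      refine tendsto_const_nhds.sub (Real.tendsto_exp_neg_atTop_nhds_zero.comp
        (NNReal.tendsto_coe_atTop.2 ((ht.tendsto hF hF0).comp ?_)))
      exact tendsto_atTop_mono (fun m => Nat.le_add_left m n) tendsto_id
    have h3 : (1 : ℝ) ≤ P.real (U n) := by
      simpa using le_of_tendsto h2 (Eventually.of_forall h1)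
    have h4 : P.real (U n) = 1 := le_antisymm measureReal_le_one h3
    rw [← ofReal_measureReal, h4, ENNReal.ofReal_one]
  have hfreq0 : ∀ᵐ ω ∂P, ∃ᶠ k in atTop, Y (t k) ω = 0 := by
    have : ∀ᵐ ω ∂P, ∀ n, ω ∈ U n :=
      ae_all_iff.2 fun n => (prob_compl_eq_zero_iff (hUm n)).2 (hU n)
    filter_upwards [this] with ω hω
    refine frequently_atTop.2 fun n => ?_
    obtain ⟨k, hk⟩ := Set.mem_iUnion.1 (hω n)
    exact ⟨n + k, Nat.le_add_right n k, hk⟩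
  have hfreq1 : ∀ᵐ ω ∂P, ∃ᶠ k in atTop, Y (t k) ω ≠ 0 := by
    have : ∀ᵐ ω ∂P, ∀ n, ω ∉ ⋂ k, {ω | Y (t (n + k)) ω = 0} :=
      ae_all_iff.2 fun n => measure_eq_zero_iff_ae_notMem.1
        (hY.measure_iInter_eq_zero hf (ht.shift hF hF0 n))
    filter_upwards [this] with ω hω
    refine frequently_atTop.2 fun n => ?_
    have h := hω n
    simp only [Set.mem_iInter, not_forall] at h
    obtain ⟨k, hk⟩ := h
    exact ⟨n + k, Nat.le_add_right n k, hk⟩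
  have hae : ∀ᵐ ω ∂P, jumpsZeroOne (fun t => Y t ω) = ⊤ := by
    filter_upwards [hfreq0, hfreq1] with ω h0 h1
    exact (hY.paths ω).jumpsZeroOne_eq_top hmono h0 h1
  rw [measure_congr (eventuallyEq_univ.2 hae), measure_univ]

end DivergentCase

theorem theorem3 {Ω : Type*} [MeasurableSpace Ω] (P : Measure Ω) [IsProbabilityMeasure P]
    (f : ℝ≥0 → ℝ≥0) (hf : Monotone f) (Y : ℝ≥0 → Ω → ℕ)
    (hY : IsBirthDeathProcess P (fun t _ => (f t : ℝ)) (fun _ n => (n : ℝ)) Y)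
    (hY0 : ∀ ω : Ω, Y 0 ω = 1) :
    (P {ω | jumpsZeroOne (fun t => Y t ω) = ⊤} = 1 ↔
      ∫⁻ t in Set.Ici (0 : ℝ),
        ENNReal.ofReal (Real.exp (-(f t.toNNReal : ℝ)) * f t.toNNReal) = ⊤) ∧
    (∫⁻ t in Set.Ici (0 : ℝ),
        ENNReal.ofReal (Real.exp (-(f t.toNNReal : ℝ)) * f t.toNNReal) ≠ ⊤ →
      P {ω | jumpsZeroOne (fun t => Y t ω) = ⊤} = 0) := by
  have hconv := IsImmigrationDeathProcess.measure_jumpsZeroOne_eq_top_of_ne_top hf hY hY0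
  refine ⟨⟨fun h1 => ?_,
    IsImmigrationDeathProcess.measure_jumpsZeroOne_eq_top_of_eq_top hf hY hY0⟩, hconv⟩
  by_contra hne
  rw [hconv hne] at h1
  exact zero_ne_one h1
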